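/- Consider $C$ clusters of $N$ active users in slotted time. All active users follow, independently of each other, the same ergodic Markov chain (on a countable state space), which determines in each slot whether the user transmits. The delivery process of an active user is $S(t)=1$ if in slot $t$ it is the only active user of its cluster that transmits, and $S(t)=0$ otherwise; the passive detection process, attached to a passive user, is $S(t)=1$ if no active user of the network transmits in slot $t$, and $S(t)=0$ otherwise. The mean and temporal variance of such a process $S$ are $$m=\lim_{T\to\infty}\frac{1}{T}\sum_{t=1}^{T}S(t)\ \text{(almost surely)},\qquad v^2=\lim_{T\to\infty}E\Big[\Big(\frac{\sum_{t=1}^{T}S(t)-Tm}{\sqrt T}\Big)^2\Big],$$ denoted $(m_a,v_a^2)$ for an active user and $(m_p,v_p^2)$ for a passive user. Let $(m,v^2)$ be either of these two pairs; assume that the limits exist and that $m>0$, $v^2>0$. Let $D$ be a Brownian motion with drift $m$ and variance $v^2$ started at $0$, put $t'_0=0$ and $t'_{i}=\min\{t>t'_{i-1}: D(t)-D(t'_{i-1})\ge 1\}$ for $i\ge1$, and let $l'(i)=t'_i-t'_{i-1}$ be the inter-delivery times of this approximation. Let $z\ge1$ be an integer, let $F_z$ be the polynomial with $F_z(l)=\sum_{k=1}^{l}k^z$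 for all positive integers $l$, and define the approximated $z$-th moment of the age of information (AoI) of the user by replacing the true inter-delivery times by the $l'(i)$ in the renewal-reward average of the age: $$E[\widetilde{AoI}^z]=E\Big[\lim_{L\to\infty}\frac{\sum_{i=1}^{L}F_z(l'(i))}{\sum_{i=1}^{L}l'(i)}\Big].$$ Then, for active users ($m=m_a$, $v^2=v_a^2$) as well as for passive users ($m=m_p$, $v^2=v_p^2$): (i) almost surely all the minima $t'_i$ exist, and each $l'(i)$ has the inverse Gaussian distribution $IG(\frac1m,\frac1{v^2})$ with mean $\frac1m$ and shape parameter $\frac1{v^2}$; (ii) the limit above exists almost surely, and with the Bernoulli numbers $B_\kappa$, for every $i\ge1$, $$E[\widetilde{AoI}^z]=\frac{1}{E[l'(i)]}\Big(\frac{E[l'(i)^{z+1}]}{z+1}+\frac{E[l'(i)^z]}{2}+\sum_{\kappa=2}^{z}\frac{B_\kappa}{\kappa!}\,\frac{z!\,E[l'(i)^{z-\kappa+1}]}{(z-\kappa+1)!}\Big);$$ (iii) for all integers $i,\kappa\ge1$, the moment $E[l'(i)^\kappa]$ is finite and $$E[l'(i)^{\kappa}]=\frac{1}{m^{\kappa}}\sum_{\zeta=0}^{\kappa-1}\frac{(\kappa-1+\zeta)!}{\zeta!\,(\kappa-1-\zeta)!}\Big(\frac{2m}{v^2}\Big)^{-\zeta}.$$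 -/

import Mathlib

open MeasureTheory ProbabilityTheory Filter Topology
open scoped NNReal ENNReal

noncomputable section

namespace AoI

/-! ### The random access network -/

/-- The Markov transition rule that every active user follows: a transition kernel on the state
space `α`, and the set `tx` of states in which the user transmits. -/
structure UserChain (α : Type*) where
  trans : α → PMF α
  tx : Set α

/-- The law of the state after `k` steps when started from `x`. -/
def UserChain.nStep {α : Type*} (K : UserChain α) (x : α) : ℕ → PMF α
  | 0 => PMF.pure x
  | k + 1 => (K.nStep x k).bind K.trans

/-- Ergodicity: the chain is irreducible and has a stationary distribution
(irreducible and positive recurrent). -/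
def UserChain.IsErgodic {α : Type*} (K : UserChain α) : Prop :=
  (∀ x y, ∃ k, 0 < K.nStep x k y) ∧ ∃ π : PMF α, π.bind K.trans = π

/-- `X (c, n) t` is the state in slot `t` of the active user `n` of cluster `c`, in a network of
`C` clusters with `N` active users each: the users move independently of each other, each one
according to the transition rule `K`. -/
structure IsNetwork {α Ω : Type*} [MeasurableSpace α] [MeasurableSpace Ω] {C N : ℕ}
    (K : UserChain α) (X : Fin C × Fin N → ℕ → Ω → α) (P : Measure Ω) : Prop where
  measurable : ∀ u t, Measurable (X u t)
  markov : ∀ u (t : ℕ) (x : ℕ → α),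
    P {ω | ∀ s ≤ t + 1, X u s ω = x s}
      = P {ω | ∀ s ≤ t, X u s ω = x s} * K.trans (x t) (x (t + 1))
  indep : iIndepFun (fun u ω t => X u t ω) P

/-- The delivery process of the active user `(c, n)`: in slot `t` it is `1` if that user is the
only active user of its cluster that transmits, and `0` otherwise. -/
def delivery {α Ω : Type*} {C N : ℕ} (K : UserChain α) (X : Fin C × Fin N → ℕ → Ω → α)
    (c : Fin C) (n : Fin N) (t : ℕ) : Ω → ℝ :=
  Set.indicator {ω | X (c, n) t ω ∈ K.tx ∧ ∀ n', n' ≠ n → X (c, n') t ω ∉ K.tx} 1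

/-- The passive detection process: in slot `t` it is `1` if no active user of the whole network
transmits, and `0` otherwise. -/
def detection {α Ω : Type*} {C N : ℕ} (K : UserChain α) (X : Fin C × Fin N → ℕ → Ω → α)
    (t : ℕ) : Ω → ℝ :=
  Set.indicator {ω | ∀ u, X u t ω ∉ K.tx} 1

/-- `m` is the mean of the process `S`: almost surely `(S 1 + ⋯ + S T) / T → m`. -/
def HasMean {Ω : Type*} [MeasurableSpace Ω] (S : ℕ → Ω → ℝ) (P : Measure Ω) (m : ℝ) : Prop :=
  ∀ᵐ ω ∂P, Tendsto (fun T : ℕ => (∑ t ∈ Finset.Icc 1 T, S t ω) / T) atTop (𝓝 m)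

/-- `w` is the temporal variance of the process `S` of mean `m`:
`E[((S 1 + ⋯ + S T - T m) / √T)²] → w`. -/
def HasTemporalVariance {Ω : Type*} [MeasurableSpace Ω] (S : ℕ → Ω → ℝ) (P : Measure Ω)
    (m w : ℝ) : Prop :=
  Tendsto (fun T : ℕ => ∫ ω, ((∑ t ∈ Finset.Icc 1 T, S t ω - T * m) / √T) ^ 2 ∂P) atTop (𝓝 w)

/-! ### The Brownian approximation of the inter-delivery times -/

/-- `D` is a Brownian motion with drift (mean) `m` and variance `v ^ 2`, started at `0`:
`D t = m t + v B t` for a standard Brownian motion `B`. -/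
def IsBrownianWithDrift {Ω : Type*} [MeasurableSpace Ω] (D : ℝ≥0 → Ω → ℝ) (m v : ℝ)
    (Q : Measure Ω) : Prop :=
  ∃ B : ℝ≥0 → Ω → ℝ, IsBrownianReal B Q ∧ ∀ t ω, D t ω = m * t + v * B t ω

/-- The times in `(s, ∞)` at which `D` has increased by at least one since time `s`. -/
def increaseTimes {Ω : Type*} (D : ℝ≥0 → Ω → ℝ) (ω : Ω) (s : ℝ≥0) : Set ℝ≥0 :=
  {t | s < t ∧ 1 ≤ D t ω - D s ω}

/-- The delivery times of the alternative sequence: a delivery takes place as soon as `D` has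
increased by one since the previous delivery. The clock starts at `0`. -/
def deliveryTime {Ω : Type*} (D : ℝ≥0 → Ω → ℝ) : ℕ → Ω → ℝ≥0
  | 0, _ => 0
  | i + 1, ω => sInf (increaseTimes D ω (deliveryTime D i ω))

/-- The inter-delivery times of the alternative sequence; `gap D i` is the length of the
interval between the delivery times number `i` and `i + 1`. -/
def gap {Ω : Type*} (D : ℝ≥0 → Ω → ℝ) (i : ℕ) (ω : Ω) : ℝ :=
  (deliveryTime D (i + 1) ω : ℝ) - (deliveryTime D i ω : ℝ)

/-- The inverse Gaussian distribution `IG(μ, lam)` with mean `μ` and shape `lam`. -/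
def inverseGaussian (μ lam : ℝ) : Measure ℝ :=
  volume.withDensity fun x => ENNReal.ofReal <|
    if 0 < x then
      √(lam / (2 * Real.pi * x ^ 3)) * Real.exp (-(lam * (x - μ) ^ 2) / (2 * μ ^ 2 * x))
    else 0

/-! ### Moments of the age of information -/

/-- The polynomial extension of the power sum `∑_{k=1}^{l} k ^ z` to real `l`
(see `powerSum_natCast`). -/
def powerSum (z : ℕ) (x : ℝ) : ℝ :=
  Polynomial.aeval x
    (Polynomial.C ((z + 1 : ℚ)⁻¹) *
      ((Polynomial.bernoulli (z + 1)).comp (Polynomial.X + 1)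
        - Polynomial.C ((Polynomial.bernoulli (z + 1)).eval 1)))

/-- Over an inter-delivery time `l` the age runs through `1, …, l`, so that the accumulated
`z`-th power of the age is `powerSum z l`. `IsAgeMoment l Q z a` says that `a` is the
`z`-th moment of the age for the inter-delivery times `l`, by renewal-reward averaging:
`a = E[lim_L (∑_{i<L} powerSum z (l i)) / (∑_{i<L} l i)]`, the limit existing almost surely. -/
def IsAgeMoment {Ω : Type*} [MeasurableSpace Ω] (l : ℕ → Ω → ℝ) (Q : Measure Ω) (z : ℕ)
    (a : ℝ) : Prop :=
  ∃ Y : Ω → ℝ, Integrable Y Q ∧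
    (∀ᵐ ω ∂Q, Tendsto
      (fun L : ℕ => (∑ i ∈ Finset.range L, powerSum z (l i ω)) / ∑ i ∈ Finset.range L, l i ω)
      atTop (𝓝 (Y ω))) ∧
    ∫ ω, Y ω ∂Q = a

theorem powerSum_natCast (z l : ℕ) (hz : 1 ≤ z) :
    powerSum z (l : ℝ) = ∑ k ∈ Finset.Icc 1 l, (k : ℝ) ^ z := by
  have h := Polynomial.sum_range_pow_eq_bernoulli_sub (l + 1) z
  have h1 : (Polynomial.bernoulli (z + 1)).eval (1 : ℚ) = _root_.bernoulli (z + 1) := by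
    rw [Polynomial.bernoulli_eval_one, bernoulli_eq_bernoulli'_of_ne_one (by omega)]
  have h2 : ∑ k ∈ Finset.range (l + 1), (k : ℚ) ^ z =
      ∑ k ∈ Finset.Icc 1 l, (k : ℚ) ^ z := by
    rw [Finset.sum_range_succ', Finset.range_eq_Ico, Finset.sum_Ico_add' (fun k : ℕ => (k : ℚ) ^ z)]
    have : Finset.Ico (0 + 1) (l + 1) = Finset.Icc 1 l := rfl
    simp [this, show z ≠ 0 by omega]
  have h3 : ∑ k ∈ Finset.Icc 1 l, (k : ℝ) ^ z =
      ((∑ k ∈ Finset.Icc 1 l, (k : ℚ) ^ z : ℚ) : ℝ) := by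
    push_cast; rfl
  have h4 : (l : ℝ) = algebraMap ℚ ℝ (l : ℚ) := by simp
  rw [powerSum, h3, h4, Polynomial.aeval_algebraMap_apply, ← h2, eq_ratCast]
  congr 1
  simp only [Polynomial.coe_aeval_eq_eval, Polynomial.eval_mul, Polynomial.eval_C,
    Polynomial.eval_sub, Polynomial.eval_comp, Polynomial.eval_add, Polynomial.eval_X,
    Polynomial.eval_one]
  push_cast at h
  rw [h1, ← h, ← mul_assoc, inv_mul_cancel₀ (by positivity), one_mul]

end AoI

end

/-! The gaps between deliveries are the times that a Brownian motion `D` with drift `m > 0` takes to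
climb from each natural number to the next.

For `θ ≥ 0` put `l = m θ + v² θ² / 2`. Then `exp (θ D t - l t)` is a martingale
(`martingale_exp_brownian`). Optional sampling in continuous time
(`setIntegral_martingale_stoppingTime`), applied at the passage times `T i` and `T (i + 1)` of the
levels `i` and `i + 1`, where `D` takes exactly the values `i` and `i + 1`, gives
`E[exp (-l (T (i + 1) - T i)) | past of T i] = exp (-θ)` (`setIntegral_exp_hit_sub`). The right-hand
side is the Laplace transform of the inverse Gaussian distribution at `l`
(`integral_exp_inverseGaussian`), because tilting its density by an exponential only changes the
drift. As a measure on the half line is determined by its Laplace transform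
(`ext_of_integral_exp_neg_nat_mul`), each gap is inverse Gaussian and independent of the earlier
gaps (`gap_law_of_isGoodPath`). No strong Markov property is needed.

The moments of the inverse Gaussian distribution come from its total mass and its mean, for which
there are explicit primitives (`integral_exp_mul_deriv`), and from a three-term recurrence obtained
by integration by parts (`integral_pow_mul_passageDensity_succ_succ`), which the closed form
satisfies too (`momentSum_rec`). The age moment is then the ratio of two limits given by the strong
law of large numbers (`isAgeMoment_of_hasLaw`), once `powerSum` is expanded in Bernoulli numbers
(`powerSum_eq`). -/

noncomputable section

namespace AoI

/-! ### The density of the inverse Gaussian distribution -/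

/-- The density on `(0, ∞)` of the inverse Gaussian distribution `IG(1 / m, 1 / v ^ 2)`, written in
terms of the drift `m` and the standard deviation `v` of the underlying Brownian motion. -/
def passageDensity (m v x : ℝ) : ℝ :=
  (v * √(2 * Real.pi) * (x * √x))⁻¹ * Real.exp (-(m * x - 1) ^ 2 / (2 * v ^ 2 * x))

lemma passageDensity_nonneg {m v x : ℝ} (hv : 0 < v) (hx : 0 < x) : 0 ≤ passageDensity m v x := by
  unfold passageDensity; positivity

lemma measurable_passageDensity (m v : ℝ) : Measurable (passageDensity m v) := by
  unfold passageDensity; fun_prop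

lemma inverseGaussian_eq {m v : ℝ} (hm : 0 < m) (hv : 0 < v) :
    inverseGaussian (1 / m) (1 / v ^ 2) =
      (volume.restrict (Set.Ioi 0)).withDensity fun x ↦ ENNReal.ofReal (passageDensity m v x) := by
  rw [← withDensity_indicator measurableSet_Ioi, inverseGaussian]
  congr 1
  ext x
  by_cases hx : 0 < x
  · rw [if_pos hx, Set.indicator_of_mem (by simpa using hx), passageDensity]
    congr 2
    · have h : x ^ 3 = (x * √x) ^ 2 := by rw [mul_pow, Real.sq_sqrt hx.le]; ring
      rw [div_div, Real.sqrt_div' _ (by positivity), Real.sqrt_one, one_div, h,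
        Real.sqrt_mul' _ (by positivity), Real.sqrt_mul' _ (by positivity),
        Real.sqrt_sq (by positivity : 0 ≤ x * √x), Real.sqrt_sq hv.le]
      ring
    · congr 1; field_simp
  · rw [if_neg hx, Set.indicator_of_notMem (by simpa using hx)]
    simp

/-- Primitive of the unnormalised Gaussian density, vanishing at `0`. -/
def gaussPrimitive (y : ℝ) : ℝ := ∫ t in (0 : ℝ)..y, Real.exp (-t ^ 2 / 2)

lemma hasDerivAt_gaussPrimitive (y : ℝ) :
    HasDerivAt gaussPrimitive (Real.exp (-y ^ 2 / 2)) y :=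
  (by fun_prop : Continuous fun t : ℝ ↦ Real.exp (-t ^ 2 / 2)).integral_hasStrictDerivAt 0 y
    |>.hasDerivAt

lemma gaussPrimitive_neg (y : ℝ) : gaussPrimitive (-y) = -gaussPrimitive y := by
  have h := intervalIntegral.integral_comp_neg (a := 0) (b := y)
    fun t : ℝ ↦ Real.exp (-t ^ 2 / 2)
  simp only [neg_sq, neg_zero] at h
  rw [gaussPrimitive, gaussPrimitive, h, intervalIntegral.integral_symm]

lemma tendsto_gaussPrimitive_atTop :
    Tendsto gaussPrimitive atTop (𝓝 (√(2 * Real.pi) / 2)) := by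
  have h : (fun t : ℝ ↦ Real.exp (-t ^ 2 / 2)) = fun t : ℝ ↦ Real.exp (-(1 / 2) * t ^ 2) := by
    ext t; congr 1; ring
  have hi : Integrable fun t : ℝ ↦ Real.exp (-t ^ 2 / 2) := by
    rw [h]; exact integrable_exp_neg_mul_sq (by norm_num)
  have := intervalIntegral_tendsto_integral_Ioi 0 hi.integrableOn tendsto_id
  have h2 : ∫ t in Set.Ioi (0 : ℝ), Real.exp (-t ^ 2 / 2) = √(2 * Real.pi) / 2 := by
    rw [h, integral_gaussian_Ioi]; congr 2; ring
  rw [h2] at this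
  exact this

lemma tendsto_gaussPrimitive_atBot :
    Tendsto gaussPrimitive atBot (𝓝 (-(√(2 * Real.pi) / 2))) := by
  have := (tendsto_gaussPrimitive_atTop.comp tendsto_neg_atBot_atTop).neg
  refine this.congr fun y ↦ ?_
  simp [gaussPrimitive_neg]

lemma tendsto_inv_sqrt_nhdsGT_zero : Tendsto (fun x : ℝ ↦ (√x)⁻¹) (𝓝[>] 0) atTop := by
  refine tendsto_inv_nhdsGT_zero.comp (tendsto_nhdsWithin_iff.2 ⟨?_, ?_⟩)
  · have : Tendsto Real.sqrt (𝓝[>] 0) (𝓝 (√0)) :=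
      (Real.continuous_sqrt.tendsto 0).mono_left nhdsWithin_le_nhds
    simpa using this
  · filter_upwards [self_mem_nhdsWithin] with x hx using Real.sqrt_pos.2 hx

lemma tendsto_inv_sqrt_atTop : Tendsto (fun x : ℝ ↦ (√x)⁻¹) atTop (𝓝 0) :=
  tendsto_inv_atTop_zero.comp Real.tendsto_sqrt_atTop

lemma tendsto_sqrt_nhdsGT_zero : Tendsto Real.sqrt (𝓝[>] 0) (𝓝 0) := by
  have : Tendsto Real.sqrt (𝓝[>] 0) (𝓝 (√0)) :=
      (Real.continuous_sqrt.tendsto 0).mono_left nhdsWithin_le_nhds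
  simpa using this

/-- With `a = (m x - 1) / (v √x)` and `b = -(m x + 1) / (v √x)` one has
`exp (-a² / 2) = exp (2 m / v²) exp (-b² / 2)`, so that `exp (-a² / 2) (a' + s b')` is the
derivative of `Φ a + s exp (2 m / v²) Φ b`. The cases `s = 1` and `s = -1` give the total mass and
the mean of the inverse Gaussian distribution. -/
lemma integral_exp_mul_deriv {m v s : ℝ} (hm : 0 < m) (hv : 0 < v) (hs : |s| ≤ 1) :
    IntegrableOn (fun x ↦ Real.exp (-(m * x - 1) ^ 2 / (2 * v ^ 2 * x)) *
        (((1 + s) / (x * √x) + (1 - s) * m / √x) / (2 * v))) (Set.Ioi 0) ∧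
      ∫ x in Set.Ioi 0, Real.exp (-(m * x - 1) ^ 2 / (2 * v ^ 2 * x)) *
        (((1 + s) / (x * √x) + (1 - s) * m / √x) / (2 * v)) = √(2 * Real.pi) := by
  set c := √(2 * Real.pi) / 2 with hc
  set E := Real.exp (2 * m / v ^ 2) with hE
  set a : ℝ → ℝ := fun x ↦ (m * √x - (√x)⁻¹) / v with ha
  set b : ℝ → ℝ := fun x ↦ -(m * √x + (√x)⁻¹) / v with hb
  set F : ℝ → ℝ := fun x ↦ gaussPrimitive (a x) + s * E * gaussPrimitive (b x) with hF
  have hs' := abs_le.1 hs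
  have hFd : ∀ x ∈ Set.Ioi (0 : ℝ), HasDerivAt F (Real.exp (-(m * x - 1) ^ 2 / (2 * v ^ 2 * x)) *
        (((1 + s) / (x * √x) + (1 - s) * m / √x) / (2 * v))) x := by
    intro x hx
    have hx : 0 < x := hx
    have hq : 0 < √x := Real.sqrt_pos.2 hx
    have hqx : √x ^ 2 = x := Real.sq_sqrt hx.le
    have h1 := Real.hasDerivAt_sqrt hx.ne'
    have h2 := h1.inv hq.ne'
    have hA : HasDerivAt a ((m / √x + 1 / (x * √x)) / (2 * v)) x := by
      refine (((h1.const_mul m).sub h2).div_const v).congr_deriv ?_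
      rw [hqx]; field_simp; ring
    have hB : HasDerivAt b ((1 / (x * √x) - m / √x) / (2 * v)) x := by
      refine (((h1.const_mul m).add h2).neg.div_const v).congr_deriv ?_
      rw [hqx]; field_simp; ring
    have ea : Real.exp (-a x ^ 2 / 2) = Real.exp (-(m * x - 1) ^ 2 / (2 * v ^ 2 * x)) := by
      congr 1
      simp only [ha]
      rw [← hqx]; field_simp; simp only [Real.sqrt_sq hq.le]
    have eb : E * Real.exp (-b x ^ 2 / 2) = Real.exp (-(m * x - 1) ^ 2 / (2 * v ^ 2 * x)) := by
      rw [hE, ← Real.exp_add]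
      congr 1
      simp only [hb]
      rw [← hqx]; field_simp; simp only [Real.sqrt_sq hq.le]; ring
    refine (((hasDerivAt_gaussPrimitive (a x)).comp x hA).add
      (((hasDerivAt_gaussPrimitive (b x)).comp x hB).const_mul (s * E))).congr_deriv ?_
    have : s * E * (Real.exp (-b x ^ 2 / 2) * ((1 / (x * √x) - m / √x) / (2 * v))) =
      s * (E * Real.exp (-b x ^ 2 / 2)) * ((1 / (x * √x) - m / √x) / (2 * v)) := by ring
    rw [this, ea, eb]
    ring
  have hbot : Tendsto F (𝓝[>] 0) (𝓝 (-c + s * E * -c)) := by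
    refine (tendsto_gaussPrimitive_atBot.comp ?_).add
      ((tendsto_gaussPrimitive_atBot.comp ?_).const_mul _)
    · refine Tendsto.atBot_div_const hv ?_
      have := (tendsto_sqrt_nhdsGT_zero.const_mul m).add_atBot
        (tendsto_neg_atTop_atBot.comp tendsto_inv_sqrt_nhdsGT_zero)
      simpa [sub_eq_add_neg] using this
    · refine Tendsto.atBot_div_const hv ?_
      exact tendsto_neg_atTop_atBot.comp
        ((tendsto_sqrt_nhdsGT_zero.const_mul m).add_atTop tendsto_inv_sqrt_nhdsGT_zero)
  have htop : Tendsto F atTop (𝓝 (c + s * E * -c)) := by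
    refine (tendsto_gaussPrimitive_atTop.comp ?_).add
      ((tendsto_gaussPrimitive_atBot.comp ?_).const_mul _)
    · refine Tendsto.atTop_div_const hv ?_
      have := (Real.tendsto_sqrt_atTop.const_mul_atTop hm).atTop_add tendsto_inv_sqrt_atTop.neg
      simpa [sub_eq_add_neg] using this
    · refine Tendsto.atBot_div_const hv ?_
      exact tendsto_neg_atTop_atBot.comp
        ((Real.tendsto_sqrt_atTop.const_mul_atTop hm).atTop_add tendsto_inv_sqrt_atTop)
  -- `a 0` and `b 0` are junk values, so the limit at `0` has to be put in by hand
  set G := Function.update F 0 (-c + s * E * -c) with hG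
  have hGc : ContinuousWithinAt G (Set.Ici 0) 0 := by
    rw [hG, continuousWithinAt_update_same]
    simpa using hbot
  have hGd : ∀ x ∈ Set.Ioi (0 : ℝ), HasDerivAt G (Real.exp (-(m * x - 1) ^ 2 / (2 * v ^ 2 * x)) *
        (((1 + s) / (x * √x) + (1 - s) * m / √x) / (2 * v))) x := by
    intro x hx
    refine (hFd x hx).congr_of_eventuallyEq ?_
    filter_upwards [isOpen_Ioi.mem_nhds hx] with y hy
    exact Function.update_of_ne (ne_of_gt hy) _ _
  have hGt : Tendsto G atTop (𝓝 (c + s * E * -c)) := by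
    refine htop.congr' ?_
    filter_upwards [eventually_gt_atTop 0] with y hy
    exact (Function.update_of_ne (ne_of_gt hy) _ _).symm
  have hpos : ∀ x ∈ Set.Ioi (0 : ℝ), 0 ≤ Real.exp (-(m * x - 1) ^ 2 / (2 * v ^ 2 * x)) *
        (((1 + s) / (x * √x) + (1 - s) * m / √x) / (2 * v)) := by
    intro x hx
    have hx : 0 < x := hx
    have h1 : 0 ≤ 1 + s := by linarith
    have h2 : 0 ≤ 1 - s := by linarith
    positivity
  refine ⟨integrableOn_Ioi_deriv_of_nonneg hGc hGd hpos hGt, ?_⟩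
  rw [integral_Ioi_of_hasDerivAt_of_nonneg hGc hGd hpos hGt, hG, Function.update_self, hc]
  ring

lemma integrableOn_passageDensity {m v : ℝ} (hm : 0 < m) (hv : 0 < v) :
    IntegrableOn (passageDensity m v) (Set.Ioi 0) := by
  refine IntegrableOn.congr_fun ((integral_exp_mul_deriv (s := 1) hm hv (by simp)).1.const_mul
    (√(2 * Real.pi))⁻¹) (fun x hx ↦ ?_) measurableSet_Ioi
  have hx : 0 < x := hx
  simp only [passageDensity]; field_simp; ring

lemma integral_passageDensity {m v : ℝ} (hm : 0 < m) (hv : 0 < v) :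
    ∫ x in Set.Ioi 0, passageDensity m v x = 1 := by
  have h := (integral_exp_mul_deriv (s := 1) hm hv (by simp)).2
  rw [setIntegral_congr_fun measurableSet_Ioi
    (g := fun x ↦ √(2 * Real.pi) * passageDensity m v x), integral_const_mul] at h
  · have : √(2 * Real.pi) ≠ 0 := by positivity
    exact (mul_eq_left₀ this).1 h
  · intro x hx
    have hx : 0 < x := hx
    simp only [passageDensity]; field_simp; ring

lemma integral_mul_passageDensity {m v : ℝ} (hm : 0 < m) (hv : 0 < v) :
    ∫ x in Set.Ioi 0, x * passageDensity m v x = 1 / m := by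
  have h := (integral_exp_mul_deriv (s := -1) hm hv (by simp)).2
  rw [setIntegral_congr_fun measurableSet_Ioi
    (g := fun x ↦ √(2 * Real.pi) * m * (x * passageDensity m v x)), integral_const_mul] at h
  · have : √(2 * Real.pi) ≠ 0 := by positivity
    rw [mul_assoc] at h
    have h' : m * ∫ x in Set.Ioi 0, x * passageDensity m v x = 1 := (mul_eq_left₀ this).1 h
    rw [eq_div_iff hm.ne', mul_comm, h']
  · intro x hx
    have hx : 0 < x := hx
    simp only [passageDensity]; field_simp; ring

/-- Exponential tilting of the inverse Gaussian density changes the drift. -/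
lemma exp_mul_passageDensity {m m' v l x : ℝ} (hv : 0 < v) (hx : 0 < x)
    (h : m' ^ 2 = m ^ 2 + 2 * l * v ^ 2) :
    Real.exp (-l * x) * passageDensity m v x =
      Real.exp ((m - m') / v ^ 2) * passageDensity m' v x := by
  simp only [passageDensity]
  rw [mul_left_comm, ← Real.exp_add, mul_left_comm (Real.exp ((m - m') / v ^ 2)), ← Real.exp_add]
  congr 2
  field_simp
  linear_combination x ^ 2 * h

lemma integrableOn_pow_mul_passageDensity {m v : ℝ} (hm : 0 < m) (hv : 0 < v) (k : ℕ) :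
    IntegrableOn (fun x ↦ x ^ k * passageDensity m v x) (Set.Ioi 0) := by
  -- with this rate, `exp (l x)` times the density is a multiple of the density of drift `m / 2`
  set l : ℝ := 3 * m ^ 2 / (8 * v ^ 2) with hl
  have hl0 : 0 < l := by positivity
  have hh : (m / 2) ^ 2 = m ^ 2 + 2 * (-l) * v ^ 2 := by rw [hl]; field_simp; ring
  have hi := (integrableOn_passageDensity (half_pos hm) hv).const_mul
    (k.factorial / l ^ k * Real.exp ((m - m / 2) / v ^ 2))
  refine Integrable.mono' hi ?_ ?_
  · exact ((measurable_id.pow_const k).mul (measurable_passageDensity m v)).aestronglyMeasurable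
  · filter_upwards [ae_restrict_mem measurableSet_Ioi] with x hx
    have hx : 0 < x := hx
    have h0 := passageDensity_nonneg (m := m) hv hx
    rw [mul_assoc, ← exp_mul_passageDensity hv hx hh, Real.norm_of_nonneg (by positivity),
      ← mul_assoc]
    gcongr
    have := Real.pow_div_factorial_le_exp (l * x) (by positivity) k
    rw [mul_pow, div_le_iff₀ (by positivity)] at this
    rw [div_mul_eq_mul_div, le_div_iff₀ (by positivity)]
    simp only [neg_neg]
    linarith

/-- The recurrence for the moments, from integrating the derivative of `x ^ (k + 2)` times the
density. -/
lemma integral_pow_mul_passageDensity_succ_succ {m v : ℝ} (hm : 0 < m) (hv : 0 < v) (k : ℕ) :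
    m ^ 2 * ∫ x in Set.Ioi 0, x ^ (k + 2) * passageDensity m v x =
      (∫ x in Set.Ioi 0, x ^ k * passageDensity m v x) +
        (2 * k + 1) * v ^ 2 * ∫ x in Set.Ioi 0, x ^ (k + 1) * passageDensity m v x := by
  have i0 := integrableOn_pow_mul_passageDensity hm hv k
  have i1 := integrableOn_pow_mul_passageDensity hm hv (k + 1)
  have i2 := integrableOn_pow_mul_passageDensity hm hv (k + 2)
  set f : ℝ → ℝ := fun x ↦ x ^ (k + 2) * passageDensity m v x with hf
  set f' : ℝ → ℝ := fun x ↦ (2 * v ^ 2)⁻¹ * ((x ^ k * passageDensity m v x +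
    (2 * k + 1) * v ^ 2 * (x ^ (k + 1) * passageDensity m v x)) -
      m ^ 2 * (x ^ (k + 2) * passageDensity m v x)) with hf'
  have e : ∀ x, 0 ≤ x → f x = (v * √(2 * Real.pi))⁻¹ *
      (x ^ k * √x * Real.exp (-(m * x - 1) ^ 2 / (2 * v ^ 2 * x))) := by
    intro x hx
    rcases hx.eq_or_lt with rfl | hx
    · simp [hf]
    · simp only [hf, passageDensity]
      have hq : 0 < √x := Real.sqrt_pos.2 hx
      have key : x ^ (k + 2) * (x * √x)⁻¹ = x ^ k * √x := by
        rw [← div_eq_mul_inv, div_eq_iff (by positivity)]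
        linear_combination (-(x ^ k * x)) * Real.sq_sqrt hx.le
      rw [mul_inv]
      linear_combination ((v * √(2 * Real.pi))⁻¹ *
        Real.exp (-(m * x - 1) ^ 2 / (2 * v ^ 2 * x))) * key
  have hd : ∀ x ∈ Set.Ioi (0 : ℝ), HasDerivAt f (f' x) x := by
    intro x hx
    have hx : 0 < x := hx
    have hq : 0 < √x := Real.sqrt_pos.2 hx
    have h1 := (Real.hasDerivAt_sqrt hx.ne')
    have h2 : HasDerivAt (fun x : ℝ ↦ -(m * x - 1) ^ 2 / (2 * v ^ 2 * x))
        ((1 / x ^ 2 - m ^ 2) / (2 * v ^ 2)) x := by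
      have h3 := ((((hasDerivAt_id x).const_mul m).sub_const 1).pow 2).neg.div
        ((hasDerivAt_id x).const_mul (2 * v ^ 2)) (by
          simp only [id, ne_eq]; positivity)
      refine h3.congr_deriv ?_
      simp only [id, Pi.neg_apply, Pi.pow_apply]; field_simp; ring
    have h4 := ((((hasDerivAt_pow k x).mul h1).mul h2.exp).const_mul (v * √(2 * Real.pi))⁻¹)
    refine (h4.congr_deriv ?_).congr_of_eventuallyEq ?_
    · simp only [hf', passageDensity]
      rcases k with _ | k
      · simp
        field_simp
        rw [Real.sq_sqrt hx.le]
        ring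
      · simp
        field_simp
        rw [Real.sq_sqrt hx.le]
        ring
    · filter_upwards [isOpen_Ioi.mem_nhds hx] with y hy
      exact e y (le_of_lt hy)
  have i01 : IntegrableOn (fun x ↦ x ^ k * passageDensity m v x +
      (2 * k + 1) * v ^ 2 * (x ^ (k + 1) * passageDensity m v x)) (Set.Ioi 0) :=
    i0.add (i1.const_mul _)
  have i2' : IntegrableOn (fun x ↦ m ^ 2 * (x ^ (k + 2) * passageDensity m v x)) (Set.Ioi 0) :=
    i2.const_mul _
  -- the boundary terms vanish: at `0` by the bound `x ^ k * √x`, at infinity by integrability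
  have hfi : IntegrableOn f' (Set.Ioi 0) := (i01.sub i2').const_mul _
  have hc : ContinuousWithinAt f (Set.Ici 0) 0 := by
    have h0 : f 0 = 0 := by simp [hf]
    rw [ContinuousWithinAt, h0]
    have hlim : Tendsto (fun x : ℝ ↦ (v * √(2 * Real.pi))⁻¹ * (x ^ k * √x)) (𝓝[≥] 0) (𝓝 0) := by
      have : Continuous (fun x : ℝ ↦ (v * √(2 * Real.pi))⁻¹ * (x ^ k * √x)) := by fun_prop
      have := this.tendsto 0
      simp only [Real.sqrt_zero, mul_zero] at this
      exact this.mono_left nhdsWithin_le_nhds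
    refine squeeze_zero' ?_ ?_ hlim
    · filter_upwards [self_mem_nhdsWithin] with x hx
      have hx : 0 ≤ x := hx
      rw [e x hx]; positivity
    · filter_upwards [self_mem_nhdsWithin] with x hx
      have hx : 0 ≤ x := hx
      rw [e x hx]
      refine mul_le_mul_of_nonneg_left ?_ (by positivity)
      refine mul_le_of_le_one_right (a := x ^ k * √x) (by positivity) (Real.exp_le_one_iff.2 ?_)
      rw [neg_div]
      exact neg_nonpos.2 (by positivity)
  have ht := tendsto_zero_of_hasDerivAt_of_integrableOn_Ioi hd hfi i2
  have hI := integral_Ioi_of_hasDerivAt_of_tendsto hc hd hfi ht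
  have h0 : f 0 = 0 := by simp [hf]
  rw [h0, sub_zero, hf', integral_const_mul, integral_sub i01 i2',
    integral_add i0 (i1.const_mul _), integral_const_mul, integral_const_mul] at hI
  have h2 : (2 * v ^ 2)⁻¹ ≠ 0 := by positivity
  have := (mul_eq_zero.1 hI).resolve_left h2
  linarith

/-- The closed form of the `k`-th moment of `IG(1 / m, 1 / v ^ 2)`, up to the factor `m ^ (-k)`,
as a polynomial in `y = v ^ 2 / (2 m)`. -/
def momentSum (k : ℕ) (y : ℝ) : ℝ :=
  ∑ j ∈ Finset.range k,
    ((k - 1 + j).factorial : ℝ) / (j.factorial * (k - 1 - j).factorial) * y ^ j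

/-- The three-term recurrence of the Bessel polynomials: `momentSum k y` is the Bessel polynomial of
degree `k - 1` at `2 y`. -/
lemma momentSum_rec (k : ℕ) (y : ℝ) :
    momentSum (k + 3) y =
      momentSum (k + 1) y + 2 * (2 * (k + 1) + 1) * y * momentSum (k + 2) y := by
  simp only [momentSum]
  have hcoef : ∀ j ∈ Finset.range k,
      ((k + 3 - 1 + (j + 1)).factorial : ℝ) /
        ((j + 1).factorial * (k + 3 - 1 - (j + 1)).factorial) =
      ((k + 1 - 1 + (j + 1)).factorial : ℝ) / ((j + 1).factorial * (k + 1 - 1 - (j + 1)).factorial)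
      + 2 * (2 * (k + 1) + 1) *
       (((k + 2 - 1 + j).factorial : ℝ) / (j.factorial * (k + 2 - 1 - j).factorial)) := by
    intro j hj
    obtain ⟨i, rfl⟩ := Nat.exists_eq_add_of_lt (Finset.mem_range.1 hj)
    rw [show j + i + 1 + 3 - 1 + (j + 1) = (2 * j + i + 2) + 1 + 1 by omega,
      show j + i + 1 + 3 - 1 - (j + 1) = i + 1 + 1 by omega,
      show j + i + 1 + 1 - 1 + (j + 1) = 2 * j + i + 2 by omega,
      show j + i + 1 + 1 - 1 - (j + 1) = i by omega,
      show j + i + 1 + 2 - 1 + j = 2 * j + i + 2 by omega,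
      show j + i + 1 + 2 - 1 - j = i + 1 + 1 by omega]
    simp only [Nat.factorial_succ]
    push_cast
    field_simp
    ring
  rw [Finset.sum_range_succ' _ (k + 2), Finset.sum_range_succ _ (k + 1), Finset.sum_range_succ _ k,
    Finset.sum_range_succ' _ k, Finset.sum_range_succ _ (k + 1), Finset.sum_range_succ _ k]
  have : ∑ j ∈ Finset.range k, ((k + 3 - 1 + (j + 1)).factorial : ℝ) /
      ((j + 1).factorial * (k + 3 - 1 - (j + 1)).factorial) * y ^ (j + 1) =
      ∑ j ∈ Finset.range k, ((k + 1 - 1 + (j + 1)).factorial : ℝ) /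
        ((j + 1).factorial * (k + 1 - 1 - (j + 1)).factorial) * y ^ (j + 1) +
      2 * (2 * (k + 1) + 1) * y * ∑ j ∈ Finset.range k, ((k + 2 - 1 + j).factorial : ℝ) /
        (j.factorial * (k + 2 - 1 - j).factorial) * y ^ j := by
    rw [Finset.mul_sum, ← Finset.sum_add_distrib]
    refine Finset.sum_congr rfl fun j hj ↦ ?_
    rw [hcoef j hj]
    ring
  rw [this]
  rw [show k + 3 - 1 + (k + 1) = (2 * k + 1) + 1 + 1 by omega,
    show k + 3 - 1 - (k + 1) = 1 by omega,
    show k + 3 - 1 + (k + 1 + 1) = (2 * k + 1) + 1 + 1 + 1 by omega,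
    show k + 3 - 1 - (k + 1 + 1) = 0 by omega,
    show k + 2 - 1 + k = 2 * k + 1 by omega,
    show k + 2 - 1 - k = 1 by omega,
    show k + 2 - 1 + (k + 1) = (2 * k + 1) + 1 by omega,
    show k + 2 - 1 - (k + 1) = 0 by omega]
  simp only [Nat.factorial_succ, Nat.factorial_zero, add_zero, Nat.sub_zero, add_tsub_cancel_right,
    show k + 3 - 1 = k + 1 + 1 from rfl]
  push_cast
  field_simp
  ring

lemma integral_pow_mul_passageDensity {m v : ℝ} (hm : 0 < m) (hv : 0 < v) (k : ℕ) (hk : 1 ≤ k) :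
    ∫ x in Set.Ioi 0, x ^ k * passageDensity m v x =
      1 / m ^ k * momentSum k (v ^ 2 / (2 * m)) := by
  have h1 : ∫ x in Set.Ioi 0, x ^ 1 * passageDensity m v x =
      1 / m ^ 1 * momentSum 1 (v ^ 2 / (2 * m)) := by
    simp [momentSum, integral_mul_passageDensity hm hv]
  have h2 : ∫ x in Set.Ioi 0, x ^ 2 * passageDensity m v x =
      1 / m ^ 2 * momentSum 2 (v ^ 2 / (2 * m)) := by
    have h := integral_pow_mul_passageDensity_succ_succ hm hv 0
    simp only [pow_zero, one_mul, zero_add, integral_passageDensity hm hv, pow_one,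
      integral_mul_passageDensity hm hv] at h
    rw [← mul_right_inj' (pow_ne_zero 2 hm.ne'), h]
    simp [momentSum, Finset.sum_range_succ]
    field_simp
  suffices H : ∀ k, (∫ x in Set.Ioi 0, x ^ (k + 1) * passageDensity m v x =
      1 / m ^ (k + 1) * momentSum (k + 1) (v ^ 2 / (2 * m))) ∧
      (∫ x in Set.Ioi 0, x ^ (k + 2) * passageDensity m v x =
      1 / m ^ (k + 2) * momentSum (k + 2) (v ^ 2 / (2 * m))) by
    obtain ⟨k, rfl⟩ := Nat.exists_eq_add_of_le' hk
    exact (H k).1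
  intro k
  induction k with
  | zero => exact ⟨h1, h2⟩
  | succ k ih =>
    refine ⟨ih.2, ?_⟩
    have h := integral_pow_mul_passageDensity_succ_succ hm hv (k + 1)
    rw [show k + 1 + 1 = k + 2 from rfl, ih.1, ih.2] at h
    rw [← mul_right_inj' (pow_ne_zero 2 hm.ne'), h, show k + 1 + 2 = k + 3 from rfl, momentSum_rec]
    push_cast
    field_simp
    ring

/-! ### Integrals against the inverse Gaussian distribution -/

lemma integral_inverseGaussian {m v : ℝ} (hm : 0 < m) (hv : 0 < v) (g : ℝ → ℝ) :
    ∫ x, g x ∂(inverseGaussian (1 / m) (1 / v ^ 2)) =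
      ∫ x in Set.Ioi 0, g x * passageDensity m v x := by
  rw [inverseGaussian_eq hm hv, integral_withDensity_eq_integral_toReal_smul
    (measurable_passageDensity m v).ennreal_ofReal (by simp)]
  refine setIntegral_congr_fun measurableSet_Ioi fun x hx ↦ ?_
  simp only [smul_eq_mul]
  rw [ENNReal.toReal_ofReal (passageDensity_nonneg hv hx), mul_comm]

lemma integrable_inverseGaussian_iff {m v : ℝ} (hm : 0 < m) (hv : 0 < v) (g : ℝ → ℝ) :
    Integrable g (inverseGaussian (1 / m) (1 / v ^ 2)) ↔
      IntegrableOn (fun x ↦ g x * passageDensity m v x) (Set.Ioi 0) := by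
  rw [inverseGaussian_eq hm hv, integrable_withDensity_iff_integrable_smul'
    (measurable_passageDensity m v).ennreal_ofReal (by simp)]
  refine integrableOn_congr_fun (fun x hx ↦ ?_) measurableSet_Ioi
  simp only [smul_eq_mul]
  rw [ENNReal.toReal_ofReal (passageDensity_nonneg hv hx), mul_comm]

lemma isProbabilityMeasure_inverseGaussian {m v : ℝ} (hm : 0 < m) (hv : 0 < v) :
    IsProbabilityMeasure (inverseGaussian (1 / m) (1 / v ^ 2)) := by
  constructor
  rw [inverseGaussian_eq hm hv, withDensity_apply _ .univ, Measure.restrict_univ,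
    ← ofReal_integral_eq_lintegral_ofReal (integrableOn_passageDensity hm hv),
    integral_passageDensity hm hv, ENNReal.ofReal_one]
  filter_upwards [ae_restrict_mem measurableSet_Ioi] with x hx using passageDensity_nonneg hv hx

lemma inverseGaussian_ae_pos {m v : ℝ} (hm : 0 < m) (hv : 0 < v) :
    ∀ᵐ x ∂(inverseGaussian (1 / m) (1 / v ^ 2)), 0 < x := by
  rw [inverseGaussian_eq hm hv]
  exact (withDensity_absolutelyContinuous _ _).ae_le (ae_restrict_mem measurableSet_Ioi)

/-- The Laplace transform of the inverse Gaussian distribution, for a parameter `l` given as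
`l = m θ + v² θ² / 2` with `θ ≥ 0`. -/
lemma integral_exp_inverseGaussian {m v θ : ℝ} (hm : 0 < m) (hv : 0 < v) (hθ : 0 ≤ θ) :
    ∫ x, Real.exp (-(m * θ + v ^ 2 * θ ^ 2 / 2) * x) ∂(inverseGaussian (1 / m) (1 / v ^ 2)) =
      Real.exp (-θ) := by
  have hm' : 0 < m + v ^ 2 * θ := by positivity
  rw [integral_inverseGaussian hm hv, setIntegral_congr_fun measurableSet_Ioi
    (g := fun x ↦ Real.exp (-θ) * passageDensity (m + v ^ 2 * θ) v x), integral_const_mul,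
    integral_passageDensity hm' hv, mul_one]
  intro x hx
  simp only
  rw [exp_mul_passageDensity (m' := m + v ^ 2 * θ) hv hx (by ring)]
  congr 2
  field_simp
  ring

/-! ### Uniqueness of Laplace transforms -/

/-- A finite measure on `[0, ∞)` is determined by its Laplace transform at the natural numbers:
these are the moments of its image on `[0, 1]` under `x ↦ exp (-x)`, and polynomials are dense in
the continuous functions there. -/
lemma ext_of_integral_exp_neg_nat_mul {μ ν : Measure ℝ} [IsFiniteMeasure μ] [IsFiniteMeasure ν]
    (hμ : ∀ᵐ x ∂μ, 0 ≤ x) (hν : ∀ᵐ x ∂ν, 0 ≤ x)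
    (h : ∀ n : ℕ, ∫ x, Real.exp (-n * x) ∂μ = ∫ x, Real.exp (-n * x) ∂ν) : μ = ν := by
  set e : ℝ → ℝ := fun x ↦ Real.exp (-x) with he
  have hem : Measurable e := by fun_prop
  have bound : ∀ {ρ : Measure ℝ}, (∀ᵐ x ∂ρ, 0 ≤ x) → ∀ᵐ x ∂ρ, e x ∈ Set.Icc (0 : ℝ) 1 := by
    intro ρ hρ
    filter_upwards [hρ] with x hx
    exact ⟨(Real.exp_pos _).le, Real.exp_le_one_iff.2 (by linarith)⟩
  have hint : ∀ {ρ : Measure ℝ} [IsFiniteMeasure ρ], (∀ᵐ x ∂ρ, 0 ≤ x) → ∀ n : ℕ,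
      Integrable (fun x ↦ e x ^ n) ρ := by
    intro ρ _ hρ n
    refine Integrable.of_bound (hem.pow_const n).aestronglyMeasurable 1 ?_
    filter_upwards [bound hρ] with x hx
    rw [norm_pow, Real.norm_of_nonneg hx.1]
    exact pow_le_one₀ hx.1 hx.2
  have hpint : ∀ {ρ : Measure ℝ} [IsFiniteMeasure ρ], (∀ᵐ x ∂ρ, 0 ≤ x) → ∀ p : Polynomial ℝ,
      Integrable (fun x ↦ p.eval (e x)) ρ := by
    intro ρ _ hρ p
    simp only [Polynomial.eval_eq_sum_range]
    exact integrable_finsetSum _ fun n _ ↦ (hint hρ n).const_mul _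
  -- the images of `μ` and `ν` under `e` give the same integral to every polynomial
  have hpow : ∀ p : Polynomial ℝ, ∫ x, p.eval (e x) ∂μ = ∫ x, p.eval (e x) ∂ν := by
    intro p
    simp only [Polynomial.eval_eq_sum_range]
    rw [integral_finsetSum _ fun n _ ↦ (hint hμ n).const_mul _,
      integral_finsetSum _ fun n _ ↦ (hint hν n).const_mul _]
    refine Finset.sum_congr rfl fun n _ ↦ ?_
    rw [integral_const_mul, integral_const_mul]
    have := h n
    simp only [he, ← Real.exp_nat_mul]
    simp only [mul_neg, neg_mul] at this ⊢
    rw [this]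
  have hmap : μ.map e = ν.map e := by
    refine ext_of_forall_integral_eq_of_IsFiniteMeasure fun f ↦ ?_
    rw [integral_map hem.aemeasurable f.continuous.measurable.aestronglyMeasurable,
      integral_map hem.aemeasurable f.continuous.measurable.aestronglyMeasurable]
    refine eq_of_forall_dist_le fun ε hε ↦ ?_
    set M := μ.real Set.univ + ν.real Set.univ + 1 with hM
    have hM0 : 0 < M := by positivity
    obtain ⟨p, hp⟩ := exists_polynomial_near_of_continuousOn 0 1 f f.continuous.continuousOn
      (ε / M) (by positivity)
    have key : ∀ {ρ : Measure ℝ} [IsFiniteMeasure ρ], (∀ᵐ x ∂ρ, 0 ≤ x) →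
        |∫ x, f (e x) ∂ρ - ∫ x, p.eval (e x) ∂ρ| ≤ ε / M * ρ.real Set.univ := by
      intro ρ _ hρ
      have hfi : Integrable (fun x ↦ f (e x)) ρ :=
        Integrable.of_bound (f.continuous.measurable.comp hem).aestronglyMeasurable ‖f‖
          (Eventually.of_forall fun x ↦ f.norm_coe_le_norm _)
      rw [← integral_sub hfi (hpint hρ p)]
      rw [← Real.norm_eq_abs]
      refine norm_integral_le_of_norm_le_const ?_
      filter_upwards [bound hρ] with x hx
      rw [Real.norm_eq_abs, abs_sub_comm]
      exact (hp _ hx).le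
    have h1 := key (ρ := μ) hμ
    have h2 := key (ρ := ν) hν
    rw [hpow p] at h1
    rw [Real.dist_eq]
    calc _ ≤ _ := abs_sub_le _ (∫ x, p.eval (e x) ∂ν) _
      _ ≤ ε / M * μ.real Set.univ + ε / M * ν.real Set.univ := by
        rw [abs_sub_comm (∫ x, p.eval (e x) ∂ν)]; exact add_le_add h1 h2
      _ = ε / M * (M - 1) := by rw [hM]; ring
      _ ≤ ε := by rw [div_mul_eq_mul_div, div_le_iff₀ hM0]; nlinarith
  have hlog : ∀ ρ : Measure ℝ, (ρ.map e).map (fun y ↦ -Real.log y) = ρ := by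
    intro ρ
    rw [Measure.map_map (by fun_prop) hem]
    have : (fun y ↦ -Real.log y) ∘ e = id := by ext x; simp [he]
    rw [this, Measure.map_id]
  rw [← hlog μ, hmap, hlog ν]

lemma exists_laplaceExponent_eq {m v : ℝ} (hm : 0 < m) (hv : 0 < v) {l : ℝ} (hl : 0 ≤ l) :
    ∃ θ, 0 ≤ θ ∧ m * θ + v ^ 2 * θ ^ 2 / 2 = l := by
  refine ⟨(√(m ^ 2 + 2 * l * v ^ 2) - m) / v ^ 2, div_nonneg ?_ (by positivity), ?_⟩
  · rw [sub_nonneg]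
    exact Real.le_sqrt_of_sq_le (by nlinarith [mul_nonneg hl (sq_nonneg v)])
  · have := Real.sq_sqrt (show 0 ≤ m ^ 2 + 2 * l * v ^ 2 by positivity)
    field_simp
    linear_combination this

/-- A finite measure on `[0, ∞)` is a multiple of an inverse Gaussian distribution if its Laplace
transform is. -/
lemma eq_smul_inverseGaussian {m v : ℝ} (hm : 0 < m) (hv : 0 < v) {μ : Measure ℝ}
    [IsFiniteMeasure μ] (hμ : ∀ᵐ x ∂μ, 0 ≤ x)
    (h : ∀ θ, 0 ≤ θ → ∫ x, Real.exp (-(m * θ + v ^ 2 * θ ^ 2 / 2) * x) ∂μ =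
      μ.real Set.univ * Real.exp (-θ)) :
    μ = μ Set.univ • inverseGaussian (1 / m) (1 / v ^ 2) := by
  have := isProbabilityMeasure_inverseGaussian hm hv
  have : IsFiniteMeasure (μ Set.univ • inverseGaussian (1 / m) (1 / v ^ 2)) :=
    Measure.smul_finite _ (measure_ne_top _ _)
  refine ext_of_integral_exp_neg_nat_mul hμ
    (Measure.ae_smul_measure ((inverseGaussian_ae_pos hm hv).mono fun x hx ↦ hx.le) _) fun n ↦ ?_
  obtain ⟨θ, hθ, hn⟩ := exists_laplaceExponent_eq hm hv (Nat.cast_nonneg n)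
  rw [← hn, h θ hθ, integral_smul_measure, integral_exp_inverseGaussian hm hv hθ]
  rfl

/-! ### Optional sampling in continuous time -/

/-- The approximation of the time `t` from above, at distance at most `1 / (n + 1)`, by the next
multiple of `1 / (n + 1)` that is larger than `t`. -/
def gridTime (n : ℕ) (t : ℝ≥0) : ℝ≥0 := (⌊(n + 1 : ℝ≥0) * t⌋₊ + 1) / (n + 1)

lemma le_gridTime (n : ℕ) (t : ℝ≥0) : t ≤ gridTime n t := by
  rw [gridTime, le_div_iff₀ (by positivity), mul_comm]
  exact (Nat.lt_floor_add_one _).le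

lemma gridTime_le (n : ℕ) (t : ℝ≥0) : gridTime n t ≤ t + 1 / (n + 1) := by
  have h : (t + 1 / (n + 1)) * (n + 1) = (n + 1) * t + 1 := by field_simp
  rw [gridTime, div_le_iff₀ (by positivity), h]
  gcongr
  exact Nat.floor_le (by positivity)

lemma gridTime_le_iff (n : ℕ) (s t : ℝ≥0) :
    gridTime n s ≤ t ↔ s < (⌊(n + 1 : ℝ≥0) * t⌋₊ : ℝ≥0) / (n + 1) := by
  rw [gridTime, div_le_iff₀ (by positivity), lt_div_iff₀ (by positivity), mul_comm s,
    ← Nat.floor_lt (by positivity), Nat.lt_iff_add_one_le, Nat.le_floor_iff (by positivity),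
    mul_comm t]
  push_cast
  rfl

lemma tendsto_gridTime (t : ℝ≥0) : Tendsto (fun n ↦ gridTime n t) atTop (𝓝 t) := by
  refine tendsto_of_tendsto_of_tendsto_of_le_of_le tendsto_const_nhds ?_
    (fun n ↦ le_gridTime n t) (fun n ↦ gridTime_le n t)
  have : Tendsto (fun n : ℕ ↦ (1 : ℝ≥0) / (n + 1)) atTop (𝓝 0) :=
    tendsto_one_div_add_atTop_nhds_zero_nat
  simpa using this.const_add t

variable {Ω : Type*} {mΩ : MeasurableSpace Ω} {μ : Measure Ω}

lemma isStoppingTime_gridTime {𝓕 : Filtration ℝ≥0 mΩ} {T : Ω → ℝ≥0}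
    (hT : IsStoppingTime 𝓕 (fun ω ↦ (T ω : WithTop ℝ≥0))) (n : ℕ) :
    IsStoppingTime 𝓕 (fun ω ↦ (gridTime n (T ω) : WithTop ℝ≥0)) := by
  intro t
  have hle : (⌊(n + 1 : ℝ≥0) * t⌋₊ : ℝ≥0) / (n + 1) ≤ t := by
    rw [div_le_iff₀ (by positivity), mul_comm t]
    exact Nat.floor_le (by positivity)
  convert hT.measurableSet_lt_le hle using 1
  ext ω
  simp only [WithTop.coe_le_coe, WithTop.coe_lt_coe, Set.mem_ofPred_eq]
  exact gridTime_le_iff n (T ω) t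

/-- **Optional sampling** in continuous time: a martingale with continuous paths has the same
integral at a bounded stopping time `T` as at a later fixed time, over every event of the past of
`T`. It follows from the version for stopping times with countable range, applied on grids, since
the conditional expectations that arise are uniformly integrable. -/
lemma setIntegral_martingale_stoppingTime [IsFiniteMeasure μ] {𝓕 : Filtration ℝ≥0 mΩ}
    {M : ℝ≥0 → Ω → ℝ} (hM : Martingale M 𝓕 μ) (hc : ∀ ω, Continuous (M · ω)) {T : Ω → ℝ≥0}
    (hT : IsStoppingTime 𝓕 (fun ω ↦ (T ω : WithTop ℝ≥0))) {K : ℝ≥0} (hK : ∀ ω, T ω ≤ K)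
    {A : Set Ω} (hA : MeasurableSet[hT.measurableSpace] A) :
    ∫ ω in A, M (T ω) ω ∂μ = ∫ ω in A, M (K + 1) ω ∂μ := by
  have hTn := isStoppingTime_gridTime hT
  have hTK : ∀ n ω, (gridTime n (T ω) : WithTop ℝ≥0) ≤ ((K + 1 : ℝ≥0) : WithTop ℝ≥0) := by
    intro n ω
    refine WithTop.coe_le_coe.2 ((gridTime_le n _).trans (add_le_add (hK ω) ?_))
    rw [div_le_iff₀ (by positivity)]
    simp
  have hcount : ∀ n, (Set.range fun ω ↦ (gridTime n (T ω) : WithTop ℝ≥0)).Countable := by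
    intro n
    refine (Set.countable_range fun k : ℕ ↦
      (((k + 1 : ℝ≥0) / (n + 1) : ℝ≥0) : WithTop ℝ≥0)).mono ?_
    rintro _ ⟨ω, rfl⟩
    exact ⟨_, rfl⟩
  have hle : ∀ n, (hTn n).measurableSpace ≤ mΩ := fun n ↦ (hTn n).measurableSpace_le
  have hcond : ∀ n, (fun ω ↦ M (gridTime n (T ω)) ω) =ᵐ[μ] μ[M (K + 1) | (hTn n).measurableSpace] :=
    fun n ↦ hM.stoppedValue_ae_eq_condExp_of_le_const_of_countable_range (hTn n) (hTK n) (hcount n)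
  have hUI : UniformIntegrable (fun n ω ↦ M (gridTime n (T ω)) ω) 1 μ :=
    ((hM.integrable (K + 1)).uniformIntegrable_condExp hle).ae_eq fun n ↦ (hcond n).symm
  have hlim : ∀ᵐ ω ∂μ, Tendsto (fun n ↦ M (gridTime n (T ω)) ω) atTop (𝓝 (M (T ω) ω)) :=
    Eventually.of_forall fun ω ↦ ((hc ω).tendsto _).comp (tendsto_gridTime _)
  have hmem : MemLp (fun ω ↦ M (T ω) ω) 1 μ := hUI.memLp_of_ae_tendsto hlim
  have hint : ∀ n, Integrable (fun ω ↦ M (gridTime n (T ω)) ω) μ := fun n ↦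
    memLp_one_iff_integrable.1 (hUI.memLp n)
  have hL1 := tendsto_Lp_finite_of_tendsto_ae le_rfl ENNReal.one_ne_top
    (fun n ↦ (hint n).1) hmem hUI.unifIntegrable hlim
  have hset := tendsto_setIntegral_of_L1' _ hmem.1 (Eventually.of_forall hint) hL1 A
  refine tendsto_nhds_unique hset (tendsto_const_nhds.congr fun n ↦ ?_)
  have hA' : MeasurableSet[(hTn n).measurableSpace] A :=
    hT.measurableSpace_mono (hTn n) (fun ω ↦ WithTop.coe_le_coe.2 (le_gridTime n _)) A hA
  rw [setIntegral_congr_ae (hle n A hA') ((hcond n).mono fun ω h _ ↦ h),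
    setIntegral_condExp (hle n) (hM.integrable _) hA']

/-! ### The exponential martingale -/

/-- The exponential martingale of a Brownian motion. -/
lemma martingale_exp_brownian {B : ℝ≥0 → Ω → ℝ} (hB : IsPreBrownianReal B μ)
    (hBm : ∀ t, StronglyMeasurable (B t)) (σ : ℝ) :
    Martingale (fun t ω ↦ Real.exp (σ * B t ω - σ ^ 2 / 2 * t)) (Filtration.natural B hBm) μ := by
  have := hB.isGaussianProcess.isProbabilityMeasure
  have hadapt : StronglyAdapted (Filtration.natural B hBm) B :=
    Filtration.stronglyAdapted_natural hBm
  have hsm : StronglyAdapted (Filtration.natural B hBm)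
      (fun t ω ↦ Real.exp (σ * B t ω - σ ^ 2 / 2 * t)) := fun t ↦
    Real.continuous_exp.comp_stronglyMeasurable
      (((hadapt t).const_mul σ).sub stronglyMeasurable_const)
  have hint : ∀ t : ℝ≥0, Integrable (fun ω ↦ Real.exp (σ * B t ω)) μ := by
    intro t
    have h := integrable_exp_mul_gaussianReal (μ := 0) (v := t) σ
    rw [← (hB.hasLaw_eval t).map_eq] at h
    exact h.comp_aemeasurable (hB.aemeasurable t)
  refine ⟨hsm, fun s t hst ↦ ?_⟩
  obtain ⟨u, rfl⟩ := exists_add_of_le hst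
  have hsplit : (fun ω ↦ Real.exp (σ * B (s + u) ω - σ ^ 2 / 2 * (s + u : ℝ≥0))) =
      (fun ω ↦ Real.exp (σ * B s ω - σ ^ 2 / 2 * s)) *
        fun ω ↦ Real.exp (σ * (B (s + u) ω - B s ω) - σ ^ 2 / 2 * u) := by
    ext ω
    rw [Pi.mul_apply, ← Real.exp_add]
    congr 1
    push_cast
    ring
  have hshift := hB.shift s
  have hincr : ∫ ω, Real.exp (σ * (B (s + u) ω - B s ω) - σ ^ 2 / 2 * u) ∂μ = 1 := by
    have := mgf_gaussianReal (hshift.hasLaw_eval u).map_eq σ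
    rw [mgf] at this
    simp only [Real.exp_sub, integral_div, this]
    rw [div_eq_one_iff_eq (Real.exp_ne_zero _)]
    congr 1
    ring
  have hinti : Integrable (fun ω ↦ Real.exp (σ * (B (s + u) ω - B s ω) - σ ^ 2 / 2 * u)) μ :=
    Integrable.of_integral_ne_zero (by rw [hincr]; exact one_ne_zero)
  have hintt : Integrable (fun ω ↦ Real.exp (σ * B (s + u) ω - σ ^ 2 / 2 * (s + u : ℝ≥0))) μ := by
    simp only [Real.exp_sub]
    exact (hint _).div_const _
  beta_reduce
  rw [hsplit] at hintt ⊢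
  refine (condExp_mul_of_stronglyMeasurable_left (hsm s) hintt hinti).trans ?_
  have hind : IndepFun (fun ω ↦ B (s + u) ω - B s ω) (fun ω (r : Set.Iic s) ↦ B r ω) μ :=
    (hB.indepFun_shift s).comp (φ := fun f : ℝ≥0 → ℝ ↦ f u) (ψ := id)
      (measurable_pi_apply u) measurable_id
  have hm1 : Measurable fun ω ↦ B (s + u) ω - B s ω :=
    (hBm _).measurable.sub (hBm _).measurable
  have hce : μ[fun ω ↦ Real.exp (σ * (B (s + u) ω - B s ω) - σ ^ 2 / 2 * u) |
      Filtration.natural B hBm s] =ᵐ[μ] fun _ ↦ 1 := by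
    have h := condExp_indep_eq (μ := μ)
      (f := fun ω ↦ Real.exp (σ * (B (s + u) ω - B s ω) - σ ^ 2 / 2 * u))
      hm1.comap_le ((Filtration.natural B hBm).le s) ?_ ?_
    · rwa [hincr] at h
    · have : Measurable fun x : ℝ ↦ Real.exp (σ * x - σ ^ 2 / 2 * u) := by fun_prop
      exact (this.comp (comap_measurable _)).stronglyMeasurable
    · rw [Filtration.natural_eq_comap]
      exact hind
  filter_upwards [hce] with ω hω
  rw [Pi.mul_apply, hω, mul_one]

/-! ### Passage times of a path -/

/-- The first time at which the path `x` is at level `a` or above. -/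
def hit (x : ℝ≥0 → ℝ) (a : ℝ) : ℝ≥0 := sInf {t | a ≤ x t}

/-- The paths that are continuous, start at `0` and reach every level. -/
structure IsGoodPath (x : ℝ≥0 → ℝ) : Prop where
  cont : Continuous x
  zero : x 0 = 0
  exists_le : ∀ a, ∃ t, a ≤ x t

namespace IsGoodPath

variable {x : ℝ≥0 → ℝ} (hx : IsGoodPath x)
include hx

lemma isLeast_hit (a : ℝ) : IsLeast {t | a ≤ x t} (hit x a) :=
  (isClosed_le continuous_const hx.cont).isLeast_csInf (hx.exists_le a) (OrderBot.bddBelow _)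

lemma lt_of_lt_hit {a : ℝ} {t : ℝ≥0} (h : t < hit x a) : x t < a :=
  not_le.1 fun h' ↦ h.not_ge ((hx.isLeast_hit a).2 h')

lemma apply_hit {a : ℝ} (ha : 0 ≤ a) : x (hit x a) = a := by
  refine le_antisymm ?_ (hx.isLeast_hit a).1
  by_contra! h
  obtain ⟨t, ht, hta⟩ := intermediate_value_Icc (zero_le : 0 ≤ hit x a) hx.cont.continuousOn
    (show a ∈ Set.Icc (x 0) (x (hit x a)) from ⟨by rwa [hx.zero], h.le⟩)
  have : t = hit x a := le_antisymm ht.2 ((hx.isLeast_hit a).2 hta.ge)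
  rw [← this, hta] at h
  exact h.false

lemma apply_le_of_le_hit {a : ℝ} (ha : 0 ≤ a) {t : ℝ≥0} (h : t ≤ hit x a) : x t ≤ a := by
  rcases h.eq_or_lt with rfl | h
  · exact (hx.apply_hit ha).le
  · exact (hx.lt_of_lt_hit h).le

lemma hit_zero : hit x 0 = 0 :=
  le_antisymm ((hx.isLeast_hit 0).2 hx.zero.ge) zero_le

lemma hit_mono {a b : ℝ} (hab : a ≤ b) : hit x a ≤ hit x b :=
  (hx.isLeast_hit a).2 (hab.trans (hx.isLeast_hit b).1)

/-- Passage up to time `t` in terms of countably many times in `[0, t]`, which makes it an event of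
the past of `t`. -/
lemma hit_le_iff (a : ℝ) (t : ℝ≥0) : hit x a ≤ t ↔
    ∀ k : ℕ, ∃ n : ℕ, a - 1 / (k + 1) < x (min (TopologicalSpace.denseSeq ℝ≥0 n) t) := by
  have hc : Continuous fun s ↦ x (min s t) := hx.cont.comp (by fun_prop)
  constructor
  · intro h k
    have hopen : IsOpen {s | a - 1 / ((k : ℝ) + 1) < x (min s t)} := isOpen_lt continuous_const hc
    obtain ⟨s, hs, n, rfl⟩ := (TopologicalSpace.denseRange_denseSeq ℝ≥0).inter_open_nonempty _ hopen
      ⟨hit x a, by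
        have h1 := (hx.isLeast_hit a).1
        have : (0 : ℝ) < 1 / (k + 1) := by positivity
        simp only [Set.mem_ofPred_eq, min_eq_left h] at h1 ⊢
        linarith⟩
    exact ⟨n, hs⟩
  · intro h
    obtain ⟨s, hs, hmax⟩ := (isCompact_Icc (a := (0 : ℝ≥0)) (b := t)).exists_isMaxOn
      ⟨0, by simp⟩ hx.cont.continuousOn
    refine ((hx.isLeast_hit a).2 ?_).trans hs.2
    have hlim : Tendsto (fun k : ℕ ↦ a - 1 / ((k : ℝ) + 1)) atTop (𝓝 a) := by
      simpa using tendsto_one_div_add_atTop_nhds_zero_nat.const_sub a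
    refine le_of_tendsto' hlim fun k ↦ ?_
    obtain ⟨n, hn⟩ := h k
    exact hn.le.trans (hmax ⟨zero_le, min_le_right _ _⟩)

end IsGoodPath


/-- At the passage time of the level `i` the path is exactly at `i`, so that it has increased by one
as soon as it is at level `i + 1`. -/
lemma increaseTimes_hit {D : ℝ≥0 → Ω → ℝ} {ω : Ω} (hD : IsGoodPath (D · ω)) (i : ℕ) :
    increaseTimes D ω (hit (D · ω) i) = {t | ((i + 1 : ℕ) : ℝ) ≤ D t ω} := by
  have hi := hD.apply_hit (Nat.cast_nonneg i)
  ext t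
  simp only [increaseTimes, Set.mem_ofPred_eq] at hi ⊢
  rw [hi]
  push_cast
  refine ⟨fun h ↦ by linarith [h.2], fun h ↦ ⟨?_, by linarith⟩⟩
  refine lt_of_le_of_ne ((hD.isLeast_hit i).2 (by simp only [Set.mem_ofPred_eq]; linarith)) ?_
  rintro rfl
  linarith

lemma deliveryTime_eq_hit {D : ℝ≥0 → Ω → ℝ} {ω : Ω} (hD : IsGoodPath (D · ω)) (i : ℕ) :
    deliveryTime D i ω = hit (D · ω) i := by
  induction i with
  | zero => simp [deliveryTime, hD.hit_zero]
  | succ i ih => rw [deliveryTime, ih, increaseTimes_hit hD, hit]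

lemma isLeast_deliveryTime {D : ℝ≥0 → Ω → ℝ} {ω : Ω} (hD : IsGoodPath (D · ω)) (i : ℕ) :
    IsLeast (increaseTimes D ω (deliveryTime D i ω)) (deliveryTime D (i + 1) ω) := by
  rw [deliveryTime_eq_hit hD, deliveryTime_eq_hit hD, increaseTimes_hit hD]
  exact hD.isLeast_hit _

lemma isStoppingTime_hit {𝓕 : Filtration ℝ≥0 mΩ} {X : ℝ≥0 → Ω → ℝ} (hX : ∀ ω, IsGoodPath (X · ω))
    (hXa : StronglyAdapted 𝓕 X) (a : ℝ) :
    IsStoppingTime 𝓕 (fun ω ↦ (hit (X · ω) a : WithTop ℝ≥0)) := by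
  intro t
  have : {ω | (hit (X · ω) a : WithTop ℝ≥0) ≤ t} = ⋂ k : ℕ, ⋃ n : ℕ,
      {ω | a - 1 / ((k : ℝ) + 1) < X (min (TopologicalSpace.denseSeq ℝ≥0 n) t) ω} := by
    ext ω
    simp only [WithTop.coe_le_coe, Set.mem_ofPred_eq, Set.mem_iInter, Set.mem_iUnion]
    exact (hX ω).hit_le_iff a t
  rw [this]
  refine MeasurableSet.iInter fun k ↦ MeasurableSet.iUnion fun n ↦ ?_
  exact measurableSet_lt measurable_const
    ((hXa (min _ t)).measurable.mono (𝓕.mono (min_le_right _ _)) le_rfl)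

lemma measurable_of_isStoppingTime {𝓕 : Filtration ℝ≥0 mΩ} {T : Ω → ℝ≥0}
    (hT : IsStoppingTime 𝓕 (fun ω ↦ (T ω : WithTop ℝ≥0))) : Measurable[hT.measurableSpace] T := by
  refine @measurable_of_Iic _ _ _ _ _ hT.measurableSpace _ _ _ _ fun t ↦ ?_
  have := hT.measurableSet_le' t
  simp only [WithTop.coe_le_coe] at this
  exact this

/-! ### The Laplace transform of the time between passages -/

/-- Optional sampling at the passage times of two levels `a ≤ b`: they are unbounded, but the
exponential martingale stays bounded up to the passage of `b`. -/
lemma setIntegral_exp_hit [IsFiniteMeasure μ] {𝓕 : Filtration ℝ≥0 mΩ} {X : ℝ≥0 → Ω → ℝ}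
    (hX : ∀ ω, IsGoodPath (X · ω)) (hXa : StronglyAdapted 𝓕 X) {θ l : ℝ} (hθ : 0 ≤ θ) (hl : 0 ≤ l)
    (hM : Martingale (fun t ω ↦ Real.exp (θ * X t ω - l * t)) 𝓕 μ) {a b : ℝ} (ha : 0 ≤ a)
    (hab : a ≤ b) {A : Set Ω}
    (hA : MeasurableSet[(isStoppingTime_hit hX hXa a).measurableSpace] A) :
    ∫ ω in A, Real.exp (θ * a - l * hit (X · ω) a) ∂μ =
      ∫ ω in A, Real.exp (θ * b - l * hit (X · ω) b) ∂μ := by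
  have hA0 : MeasurableSet A := (isStoppingTime_hit hX hXa a).measurableSpace_le A hA
  set M : ℝ≥0 → Ω → ℝ := fun t ω ↦ Real.exp (θ * X t ω - l * t) with hMdef
  have hMc : ∀ ω, Continuous (M · ω) := fun ω ↦ by
    have := (hX ω).cont
    simp only [hMdef]
    fun_prop
  have hst : ∀ c, ∀ K : ℕ,
      IsStoppingTime 𝓕 (fun ω ↦ ((min (hit (X · ω) c) (K : ℝ≥0) : ℝ≥0) : WithTop ℝ≥0)) := by
    intro c K
    exact (isStoppingTime_hit hX hXa c).min_const (K : ℝ≥0)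
  -- on `A ∩ {hit a ≤ K}` both stopped values have the same integral
  set AK : ℕ → Set Ω := fun K ↦ A ∩ {ω | (hit (X · ω) a : WithTop ℝ≥0) ≤ (K : ℝ≥0)} with hAK
  have hAKm : ∀ K, MeasurableSet[(hst a K).measurableSpace] (AK K) := fun K ↦
    ((isStoppingTime_hit hX hXa a).measurableSet_inter_le_const_iff A (K : ℝ≥0)).1
      (hA.inter ((isStoppingTime_hit hX hXa a).measurableSet_le' _))
  have hAKm0 : ∀ K, MeasurableSet (AK K) := fun K ↦ (hst a K).measurableSpace_le _ (hAKm K)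
  have heq : ∀ K : ℕ, ∫ ω in AK K, M (min (hit (X · ω) a) K) ω ∂μ =
      ∫ ω in AK K, M (min (hit (X · ω) b) K) ω ∂μ := by
    intro K
    rw [setIntegral_martingale_stoppingTime hM hMc (hst a K) (fun ω ↦ min_le_right _ _) (hAKm K),
      setIntegral_martingale_stoppingTime hM hMc (hst b K) (fun ω ↦ min_le_right _ _)]
    refine (hst a K).measurableSpace_mono (hst b K) (fun ω ↦ WithTop.coe_le_coe.2 ?_) _ (hAKm K)
    exact min_le_min_right _ ((hX ω).hit_mono hab)
  have hlim : ∀ c, 0 ≤ c → Tendsto (fun K : ℕ ↦ ∫ ω in AK K, M (min (hit (X · ω) c) K) ω ∂μ) atTop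
      (𝓝 (∫ ω in A, Real.exp (θ * c - l * hit (X · ω) c) ∂μ)) := by
    intro c hc
    have hMmeas : ∀ K : ℕ, Measurable fun ω ↦ M (min (hit (X · ω) c) K) ω := by
      intro K
      have hu : Measurable (Function.uncurry M) :=
        measurable_uncurry_of_continuous_of_measurable hMc fun t ↦ ((hM.1 t).mono (𝓕.le t)).measurable
      have hT : Measurable fun ω ↦ min (hit (X · ω) c) (K : ℝ≥0) :=
        (measurable_of_isStoppingTime (hst c K)).mono (hst c K).measurableSpace_le le_rfl
      exact hu.comp (hT.prodMk measurable_id)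
    simp only [← integral_indicator (hAKm0 _), ← integral_indicator hA0]
    refine tendsto_integral_of_dominated_convergence (fun _ ↦ Real.exp (θ * c))
      (fun K ↦ ((hMmeas K).indicator (hAKm0 K)).aestronglyMeasurable) (integrable_const _)
      (fun K ↦ Eventually.of_forall fun ω ↦ ?_) (Eventually.of_forall fun ω ↦ ?_)
    · refine (norm_indicator_le_norm_self _ _).trans ?_
      simp only [hMdef, Real.norm_eq_abs, Real.abs_exp]
      refine Real.exp_le_exp.2 ?_
      have h1 := (hX ω).apply_le_of_le_hit hc (min_le_left (hit (X · ω) c) (K : ℝ≥0))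
      have h2 := mul_le_mul_of_nonneg_left h1 hθ
      have h3 : 0 ≤ l * (min (hit (X · ω) c) K : ℝ≥0) := by positivity
      linarith
    · obtain ⟨K₀, hK₀⟩ := exists_nat_ge (max (hit (X · ω) a) (hit (X · ω) c))
      refine tendsto_const_nhds.congr' ?_
      filter_upwards [eventually_ge_atTop K₀] with K hK
      have hK' : max (hit (X · ω) a) (hit (X · ω) c) ≤ (K : ℝ≥0) := hK₀.trans (by exact_mod_cast hK)
      have h1 : min (hit (X · ω) c) (K : ℝ≥0) = hit (X · ω) c :=
        min_eq_left ((le_max_right _ _).trans hK')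
      have h2 : ω ∈ AK K ↔ ω ∈ A := by
        simp only [hAK, Set.mem_inter_iff, Set.mem_ofPred_eq, and_iff_left_iff_imp]
        exact fun _ ↦ WithTop.coe_le_coe.2 ((le_max_left _ _).trans hK')
      by_cases hω : ω ∈ A
      · rw [Set.indicator_of_mem hω, Set.indicator_of_mem (h2.2 hω), h1, hMdef]
        simp only
        rw [(hX ω).apply_hit hc]
      · rw [Set.indicator_of_notMem hω, Set.indicator_of_notMem (mt h2.1 hω)]
  exact tendsto_nhds_unique ((hlim a ha).congr heq) (hlim b (ha.trans hab))

/-- If `E[exp (-l T) | m] = c exp (-l S)` for an `m`-measurable `S ≤ T`, then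
`E[exp (-l (T - S)) | m] = c`; in terms of integrals over the events of `m`. -/
lemma setIntegral_exp_sub_of_forall {Ω : Type*} {m mΩ : MeasurableSpace Ω} {μ : Measure Ω}
    [IsFiniteMeasure μ] (hm : m ≤ mΩ) {S T : Ω → ℝ} (hS : Measurable[m] S) (hT : Measurable T)
    (hS0 : ∀ ω, 0 ≤ S ω) (hST : ∀ ω, S ω ≤ T ω) {l c : ℝ} (hl : 0 ≤ l)
    (h : ∀ A, MeasurableSet[m] A →
      ∫ ω in A, c * Real.exp (-l * S ω) ∂μ = ∫ ω in A, Real.exp (-l * T ω) ∂μ)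
    {A : Set Ω} (hA : MeasurableSet[m] A) :
    ∫ ω in A, Real.exp (-l * (T ω - S ω)) ∂μ = μ.real A * c := by
  have hbdd : ∀ R : Ω → ℝ, Measurable R → (∀ ω, 0 ≤ R ω) →
      Integrable (fun ω ↦ Real.exp (-l * R ω)) μ := by
    intro R hR hR0
    refine Integrable.of_bound (by fun_prop) 1 (Eventually.of_forall fun ω ↦ ?_)
    rw [Real.norm_eq_abs, Real.abs_exp, Real.exp_le_one_iff, neg_mul]
    exact neg_nonpos.2 (mul_nonneg hl (hR0 ω))
  have hTi := hbdd T hT fun ω ↦ (hS0 ω).trans (hST ω)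
  have hSi := (hbdd S (hS.mono hm le_rfl) hS0).const_mul c
  have hTSi := hbdd (fun ω ↦ T ω - S ω) (hT.sub (hS.mono hm le_rfl)) fun ω ↦ sub_nonneg.2 (hST ω)
  have hgm : Measurable[m] fun ω ↦ c * Real.exp (-l * S ω) :=
    (Real.measurable_exp.comp (hS.const_mul (-l))).const_mul _
  have hhm : Measurable[m] fun ω ↦ Real.exp (l * S ω) := Real.measurable_exp.comp (hS.const_mul l)
  have hcond : (fun ω ↦ c * Real.exp (-l * S ω)) =ᵐ[μ] μ[fun ω ↦ Real.exp (-l * T ω) | m] :=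
    ae_eq_condExp_of_forall_setIntegral_eq hm hTi
      (fun _ _ _ ↦ hSi.integrableOn) (fun s hs _ ↦ h s hs)
      hgm.stronglyMeasurable.aestronglyMeasurable
  have hprod : (fun ω ↦ Real.exp (l * S ω)) * (fun ω ↦ Real.exp (-l * T ω)) =
      fun ω ↦ Real.exp (-l * (T ω - S ω)) := by
    ext ω
    rw [Pi.mul_apply, ← Real.exp_add]
    congr 1
    ring
  have hpull := condExp_mul_of_stronglyMeasurable_left hhm.stronglyMeasurable (hprod ▸ hTSi) hTi
  rw [hprod] at hpull
  have hfin : μ[fun ω ↦ Real.exp (-l * (T ω - S ω)) | m] =ᵐ[μ] fun _ ↦ c := by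
    filter_upwards [hpull, hcond] with ω h1 h2
    rw [h1, Pi.mul_apply, ← h2, mul_left_comm, ← Real.exp_add]
    simp
  rw [← setIntegral_condExp hm hTSi hA, setIntegral_congr_ae (hm A hA) (hfin.mono fun ω h _ ↦ h),
    setIntegral_const, smul_eq_mul]

/-- Given the past up to the passage of the level `a`, the time from there to the passage of
`a + 1` has the Laplace transform `exp (-θ)` at `l`. -/
lemma setIntegral_exp_hit_sub [IsFiniteMeasure μ] {𝓕 : Filtration ℝ≥0 mΩ} {X : ℝ≥0 → Ω → ℝ}
    (hX : ∀ ω, IsGoodPath (X · ω)) (hXa : StronglyAdapted 𝓕 X) {θ l : ℝ} (hθ : 0 ≤ θ) (hl : 0 ≤ l)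
    (hM : Martingale (fun t ω ↦ Real.exp (θ * X t ω - l * t)) 𝓕 μ) {a : ℝ} (ha : 0 ≤ a)
    {A : Set Ω} (hA : MeasurableSet[(isStoppingTime_hit hX hXa a).measurableSpace] A) :
    ∫ ω in A, Real.exp (-l * (hit (X · ω) (a + 1) - hit (X · ω) a)) ∂μ =
      μ.real A * Real.exp (-θ) := by
  have hmeas := fun c ↦ measurable_of_isStoppingTime (isStoppingTime_hit hX hXa c)
  have hle := fun c ↦ (isStoppingTime_hit hX hXa c).measurableSpace_le
  refine setIntegral_exp_sub_of_forall (hle a) (hmeas a).coe_nnreal_real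
    ((hmeas (a + 1)).mono (hle _) le_rfl).coe_nnreal_real (fun ω ↦ NNReal.coe_nonneg _)
    (fun ω ↦ NNReal.coe_le_coe.2 ((hX ω).hit_mono (le_add_of_nonneg_right zero_le_one))) hl
    (fun s hs ↦ ?_) hA
  have key := setIntegral_exp_hit hX hXa hθ hl hM ha (le_add_of_nonneg_right zero_le_one) hs
  have e1 : ∀ ω, Real.exp (θ * a - l * hit (X · ω) a) =
      Real.exp (θ * (a + 1)) * (Real.exp (-θ) * Real.exp (-l * hit (X · ω) a)) := by
    intro ω
    rw [← Real.exp_add, ← Real.exp_add]; congr 1; ring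
  have e2 : ∀ ω, Real.exp (θ * (a + 1) - l * hit (X · ω) (a + 1)) =
      Real.exp (θ * (a + 1)) * Real.exp (-l * hit (X · ω) (a + 1)) := by
    intro ω
    rw [← Real.exp_add]; congr 1; ring
  simp only [e1, e2] at key
  rw [integral_const_mul, integral_const_mul (Real.exp (θ * (a + 1)))] at key
  exact mul_left_cancel₀ (Real.exp_ne_zero _) key

/-! ### The gaps of a Brownian motion with drift -/


/-- A Brownian motion with positive drift almost surely reaches every level, by the Chernoff bound
for its value at time `k`, as `k → ∞`. -/
lemma ae_forall_exists_le_drift {B : ℝ≥0 → Ω → ℝ} (hB : IsPreBrownianReal B μ) {m v : ℝ}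
    (hm : 0 < m) (hv : 0 < v) : ∀ᵐ ω ∂μ, ∀ a : ℝ, ∃ t : ℝ≥0, a ≤ m * t + v * B t ω := by
  have := hB.isGaussianProcess.isProbabilityMeasure
  suffices H : ∀ᵐ ω ∂μ, ∀ n : ℕ, ∃ t : ℝ≥0, (n : ℝ) ≤ m * t + v * B t ω by
    filter_upwards [H] with ω hω a
    obtain ⟨n, hn⟩ := exists_nat_ge a
    obtain ⟨t, ht⟩ := hω n
    exact ⟨t, hn.trans ht⟩
  rw [ae_all_iff]
  intro n
  have hbound : ∀ k : ℕ, μ.real {ω | ¬∃ t : ℝ≥0, (n : ℝ) ≤ m * t + v * B t ω} ≤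
      Real.exp (m * n / v ^ 2) * Real.exp (-(m ^ 2 / (2 * v ^ 2))) ^ k := by
    intro k
    have hint : Integrable (fun ω ↦ Real.exp (-(m / v) * B k ω)) μ := by
      have h := integrable_exp_mul_gaussianReal (μ := 0) (v := (k : ℝ≥0)) (-(m / v))
      rw [← (hB.hasLaw_eval k).map_eq] at h
      exact h.comp_aemeasurable (hB.aemeasurable k)
    have hch := measure_le_le_exp_mul_mgf ((n - m * k) / v)
      (neg_nonpos.2 (by positivity : 0 ≤ m / v)) hint
    rw [mgf_gaussianReal (hB.hasLaw_eval k).map_eq, ← Real.exp_add] at hch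
    refine (measureReal_mono fun ω hω ↦ ?_).trans (hch.trans_eq ?_)
    · simp only [Set.mem_ofPred_eq, not_exists, not_le] at hω ⊢
      rw [le_div_iff₀ hv]
      have := hω k
      push_cast at this
      linarith
    · rw [← Real.exp_nat_mul, ← Real.exp_add]
      congr 1
      push_cast
      field_simp
      ring
  have hlim : Tendsto (fun k : ℕ ↦
      Real.exp (m * n / v ^ 2) * Real.exp (-(m ^ 2 / (2 * v ^ 2))) ^ k) atTop (𝓝 0) := by
    have := (tendsto_pow_atTop_nhds_zero_of_lt_one (Real.exp_pos (-(m ^ 2 / (2 * v ^ 2)))).le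
      (Real.exp_lt_one_iff.2 (neg_neg_of_pos (by positivity)))).const_mul (Real.exp (m * n / v ^ 2))
    simpa using this
  have h0 := le_antisymm (ge_of_tendsto' hlim hbound) measureReal_nonneg
  exact (measureReal_eq_zero_iff).1 h0

/-- A Brownian motion with positive drift agrees almost surely with one that has only good paths
and is measurable at every time, rather than almost everywhere measurable. -/
lemma exists_goodPath_version {D : ℝ≥0 → Ω → ℝ} {m v : ℝ} (hm : 0 < m) (hv : 0 < v)
    (hD : IsBrownianWithDrift D m v μ) :
    ∃ B : ℝ≥0 → Ω → ℝ, (∀ t, StronglyMeasurable (B t)) ∧ IsPreBrownianReal B μ ∧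
      (∀ ω, IsGoodPath fun t ↦ m * t + v * B t ω) ∧
      ∀ᵐ ω ∂μ, ∀ t, D t ω = m * t + v * B t ω := by
  obtain ⟨W, hW, hDW⟩ := hD
  set q := TopologicalSpace.denseSeq ℝ≥0 with hq
  have hae : ∀ᵐ ω ∂μ, IsGoodPath (fun t ↦ m * t + v * W t ω) ∧ Continuous (W · ω) ∧
      ∀ n, W (q n) ω = (hW.aemeasurable (q n)).mk _ ω := by
    filter_upwards [hW.cont, hW.eval_zero_ae_eq_zero,
      ae_forall_exists_le_drift hW.toIsPreBrownianReal hm hv,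
      ae_all_iff.2 fun n ↦ (hW.aemeasurable (q n)).ae_eq_mk] with ω h1 h2 h3 h4
    exact ⟨⟨by fun_prop, by simp [h2], h3⟩, h1, h4⟩
  obtain ⟨G, hGae, hGm, hG⟩ := hae.exists_measurable_mem
  set B : ℝ≥0 → Ω → ℝ := fun t ↦ G.indicator (W t) with hB
  have hBc : ∀ ω, Continuous (B · ω) := by
    intro ω
    by_cases hω : ω ∈ G
    · simpa [hB, hω] using (hG ω hω).2.1
    · simpa [hB, hω] using continuous_const
  have hWB : ∀ᵐ ω ∂μ, ∀ t, W t ω = B t ω := by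
    filter_upwards [hGae] with ω hω t
    exact (Set.indicator_of_mem hω (W t)).symm
  have hBq : ∀ n, Measurable (B (q n)) := by
    intro n
    have : B (q n) = G.indicator ((hW.aemeasurable (q n)).mk _) := by
      ext ω
      by_cases hω : ω ∈ G
      · simpa [hB, hω] using (hG ω hω).2.2 n
      · simp [hB, hω]
    rw [this]
    exact (hW.aemeasurable (q n)).measurable_mk.indicator hGm
  refine ⟨B, fun t ↦ Measurable.stronglyMeasurable ?_,
    hW.toIsPreBrownianReal.congr fun t ↦ hWB.mono fun ω h ↦ h t, fun ω ↦ ?_, ?_⟩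
  · have ht : t ∈ closure (Set.range q) := (TopologicalSpace.denseRange_denseSeq ℝ≥0).closure_eq ▸
      Set.mem_univ t
    obtain ⟨s, hs, hst⟩ := mem_closure_iff_seq_limit.1 ht
    choose n hn using hs
    refine measurable_of_tendsto_metrizable (f := fun k ↦ B (s k)) (fun k ↦ ?_) ?_
    · rw [← hn k]
      exact hBq _
    · exact tendsto_pi_nhds.2 fun ω ↦ ((hBc ω).tendsto t).comp hst
  · by_cases hω : ω ∈ G
    · simpa [hB, hω] using (hG ω hω).1
    · refine ⟨by have := hBc ω; fun_prop, by simp [hB, hω], fun a ↦ ⟨Real.toNNReal (a / m), ?_⟩⟩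
      simp only [hB, hω, not_false_eq_true, Set.indicator_of_notMem, mul_zero, add_zero]
      rw [mul_comm, ← div_le_iff₀ hm]
      exact Real.le_coe_toNNReal _
  · filter_upwards [hWB] with ω hω t
    rw [hDW, hω]

lemma gap_eq_hit_sub {X : ℝ≥0 → Ω → ℝ} {ω : Ω} (hX : IsGoodPath (X · ω)) (i : ℕ) :
    gap X i ω = hit (X · ω) (i + 1) - hit (X · ω) i := by
  rw [gap, deliveryTime_eq_hit hX, deliveryTime_eq_hit hX]
  push_cast
  rfl

/-- The law and the independence of the gaps, for a Brownian motion with good paths. Both hold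
because, over every event `A` of the past of the delivery number `i`, the following gap is
distributed as `μ A` times the inverse Gaussian law. -/
lemma gap_law_of_isGoodPath {B : ℝ≥0 → Ω → ℝ} {m v : ℝ} (hm : 0 < m) (hv : 0 < v)
    (hBm : ∀ t, StronglyMeasurable (B t)) (hB : IsPreBrownianReal B μ)
    (hX : ∀ ω, IsGoodPath fun t ↦ m * t + v * B t ω) :
    (∀ i, Measurable (gap (fun t ω ↦ m * t + v * B t ω) i)) ∧
    (∀ i, μ.map (gap (fun t ω ↦ m * t + v * B t ω) i) = inverseGaussian (1 / m) (1 / v ^ 2)) ∧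
    Pairwise fun i j ↦ IndepFun (gap (fun t ω ↦ m * t + v * B t ω) i)
      (gap (fun t ω ↦ m * t + v * B t ω) j) μ := by
  have := hB.isGaussianProcess.isProbabilityMeasure
  have := isProbabilityMeasure_inverseGaussian hm hv
  set X : ℝ≥0 → Ω → ℝ := fun t ω ↦ m * t + v * B t ω with hXdef
  have hXa : StronglyAdapted (Filtration.natural B hBm) X := fun t ↦
    stronglyMeasurable_const.add ((Filtration.stronglyAdapted_natural hBm t).const_mul v)
  have hM : ∀ θ : ℝ, Martingale (fun t ω ↦ Real.exp (θ * X t ω - (m * θ + v ^ 2 * θ ^ 2 / 2) * t))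
      (Filtration.natural B hBm) μ := by
    intro θ
    convert martingale_exp_brownian hB hBm (θ * v) using 4
    simp only [hXdef]
    ring
  have hst := fun i : ℕ ↦ isStoppingTime_hit hX hXa i
  have hmeasT : ∀ i j : ℕ, i ≤ j →
      Measurable[(hst j).measurableSpace] fun ω ↦ (hit (X · ω) i : ℝ) :=
    fun i j hij ↦ ((measurable_of_isStoppingTime (hst i)).mono ((hst i).measurableSpace_mono (hst j)
      fun ω ↦ WithTop.coe_le_coe.2 ((hX ω).hit_mono (Nat.cast_le.2 hij))) le_rfl).coe_nnreal_real
  have hgap : ∀ i, gap X i = fun ω ↦ (hit (X · ω) (i + 1 : ℕ) : ℝ) - hit (X · ω) i := by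
    intro i
    ext ω
    rw [gap_eq_hit_sub (hX ω)]
    push_cast
    rfl
  have hmeasg : ∀ i j : ℕ, i + 1 ≤ j → Measurable[(hst j).measurableSpace] (gap X i) := by
    intro i j hij
    rw [hgap]
    exact (hmeasT _ _ hij).sub (hmeasT _ _ (by omega))
  have hmeas : ∀ i, Measurable (gap X i) := fun i ↦
    (hmeasg i (i + 1) le_rfl).mono (hst _).measurableSpace_le le_rfl
  have key : ∀ i A, MeasurableSet[(hst i).measurableSpace] A →
      (μ.restrict A).map (gap X i) = μ A • inverseGaussian (1 / m) (1 / v ^ 2) := by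
    intro i A hA
    have huniv : (μ.restrict A).map (gap X i) Set.univ = μ A := by
      rw [Measure.map_apply (hmeas i) .univ, Set.preimage_univ, Measure.restrict_apply_univ]
    rw [← huniv]
    refine eq_smul_inverseGaussian hm hv ?_ fun θ hθ ↦ ?_
    · rw [ae_map_iff (hmeas i).aemeasurable measurableSet_Ici]
      refine Eventually.of_forall fun ω ↦ ?_
      rw [gap_eq_hit_sub (hX ω)]
      exact sub_nonneg.2 (NNReal.coe_le_coe.2
        ((hX ω).hit_mono (le_add_of_nonneg_right zero_le_one)))
    · rw [integral_map (hmeas i).aemeasurable (by fun_prop), measureReal_def, huniv]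
      rw [← measureReal_def, ← setIntegral_exp_hit_sub hX hXa hθ (by positivity) (hM θ)
        (Nat.cast_nonneg i) hA]
      simp only [hgap, Nat.cast_succ]
      rfl
  have hlaw : ∀ i, μ.map (gap X i) = inverseGaussian (1 / m) (1 / v ^ 2) := by
    intro i
    simpa using key i Set.univ .univ
  refine ⟨hmeas, hlaw, ?_⟩
  have hlt : ∀ i j, i < j → IndepFun (gap X i) (gap X j) μ := by
    intro i j hij
    rw [indepFun_iff_measure_inter_preimage_eq_mul]
    intro s t hs ht
    have h1 := key j _ (hmeasg i j hij hs)
    have h2 := congrArg (fun ρ ↦ ρ t) h1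
    simp only [Measure.smul_apply, smul_eq_mul] at h2
    rw [Measure.map_apply (hmeas j) ht, Measure.restrict_apply (hmeas j ht)] at h2
    rw [Set.inter_comm, h2, ← hlaw j, Measure.map_apply (hmeas j) ht]
  intro i j hij
  rcases hij.lt_or_gt with h | h
  · exact hlt i j h
  · exact (hlt j i h).symm

/-- The gaps of a Brownian motion `D` with positive drift are pairwise independent with the inverse
Gaussian law; this is transferred from the version of `D` with good paths. -/
lemma hasLaw_gap_and_indepFun {D : ℝ≥0 → Ω → ℝ} {m v : ℝ} (hm : 0 < m) (hv : 0 < v)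
    (hD : IsBrownianWithDrift D m v μ) :
    (∀ᵐ ω ∂μ, ∀ i, IsLeast (increaseTimes D ω (deliveryTime D i ω)) (deliveryTime D (i + 1) ω)) ∧
    (∀ i, HasLaw (gap D i) (inverseGaussian (1 / m) (1 / v ^ 2)) μ) ∧
    Pairwise fun i j ↦ IndepFun (gap D i) (gap D j) μ := by
  obtain ⟨B, hBm, hB, hX, hDX⟩ := exists_goodPath_version hm hv hD
  set X : ℝ≥0 → Ω → ℝ := fun t ω ↦ m * t + v * B t ω with hXdef
  obtain ⟨hmeas, hlaw, hind⟩ := gap_law_of_isGoodPath hm hv hBm hB hX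
  have hpath : ∀ᵐ ω ∂μ, (D · ω) = (X · ω) := hDX.mono fun ω h ↦ funext h
  have hdel : ∀ᵐ ω ∂μ, ∀ i, gap D i ω = gap X i ω := by
    filter_upwards [hpath] with ω h i
    have hg : IsGoodPath (X · ω) := hX ω
    rw [gap_eq_hit_sub hg, gap_eq_hit_sub (h ▸ hg), h]
  have hgap : ∀ i, gap D i =ᵐ[μ] gap X i := fun i ↦ hdel.mono fun ω h ↦ h i
  refine ⟨?_, fun i ↦ ?_, fun i j hij ↦ ?_⟩
  · filter_upwards [hpath] with ω h i
    have hg : IsGoodPath (X · ω) := hX ω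
    exact isLeast_deliveryTime (h ▸ hg) i
  · exact HasLaw.congr ⟨(hmeas i).aemeasurable, hlaw i⟩ (hgap i)
  · exact (hind hij).congr (hgap i).symm (hgap j).symm

/-! ### Moments of the age of information -/

lemma powerSum_eq (z : ℕ) (hz : 1 ≤ z) (x : ℝ) :
    powerSum z x = x ^ (z + 1) / (z + 1) + x ^ z / 2 +
      ∑ κ ∈ Finset.Icc 2 z, (bernoulli κ : ℝ) / κ.factorial *
        (z.factorial * x ^ (z - κ + 1) / (z - κ + 1).factorial) := by
  have hcomp : (Polynomial.bernoulli (z + 1)).comp (Polynomial.X + 1) =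
      Polynomial.bernoulli (z + 1) + (z + 1) • Polynomial.X ^ z := by
    rw [add_comm Polynomial.X, Polynomial.bernoulli_comp_one_add_X]
    simp
  have hone : (Polynomial.bernoulli (z + 1)).eval 1 = bernoulli (z + 1) := by
    rw [Polynomial.bernoulli_eval_one, bernoulli_eq_bernoulli'_of_ne_one (by omega)]
  have hsum : Polynomial.aeval x (Polynomial.bernoulli (z + 1)) =
      x ^ (z + 1) - (z + 1) / 2 * x ^ z + (∑ κ ∈ Finset.Icc 2 z,
        (bernoulli κ : ℝ) * (z + 1).choose κ * x ^ (z - κ + 1)) + bernoulli (z + 1) := by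
    have hr : Finset.range (z + 1 + 1) = insert 0 (insert 1 (insert (z + 1) (Finset.Icc 2 z))) := by
      ext i
      simp only [Finset.mem_range, Finset.mem_insert, Finset.mem_Icc]
      omega
    rw [Polynomial.bernoulli, map_sum, hr, Finset.sum_insert (by simp),
      Finset.sum_insert (by simp; omega), Finset.sum_insert (by simp)]
    simp only [Polynomial.aeval_monomial, eq_ratCast, bernoulli_zero, bernoulli_one]
    have : ∑ κ ∈ Finset.Icc 2 z, (((bernoulli κ * (z + 1).choose κ : ℚ)) : ℝ) * x ^ (z + 1 - κ) =
        ∑ κ ∈ Finset.Icc 2 z, (bernoulli κ : ℝ) * (z + 1).choose κ * x ^ (z - κ + 1) := by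
      refine Finset.sum_congr rfl fun κ hκ ↦ ?_
      have := (Finset.mem_Icc.1 hκ).2
      rw [show z + 1 - κ = z - κ + 1 by omega]
      push_cast
      rfl
    rw [this]
    simp
    ring
  rw [powerSum, hcomp, hone]
  simp only [map_mul, map_sub, map_add, map_nsmul, map_pow, Polynomial.aeval_X, Polynomial.aeval_C,
    hsum, eq_ratCast]
  have hz1 : (z + 1 : ℝ) ≠ 0 := by positivity
  have hterm : ∑ κ ∈ Finset.Icc 2 z, (bernoulli κ : ℝ) / κ.factorial *
        (z.factorial * x ^ (z - κ + 1) / (z - κ + 1).factorial) =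
      (z + 1 : ℝ)⁻¹ * ∑ κ ∈ Finset.Icc 2 z,
        (bernoulli κ : ℝ) * (z + 1).choose κ * x ^ (z - κ + 1) := by
    rw [Finset.mul_sum]
    refine Finset.sum_congr rfl fun κ hκ ↦ ?_
    have h := (Finset.mem_Icc.1 hκ).2
    rw [Nat.cast_choose ℝ (by omega : κ ≤ z + 1), show z + 1 - κ = z - κ + 1 by omega,
      Nat.factorial_succ z]
    push_cast
    field_simp
  rw [hterm]
  push_cast
  simp only [nsmul_eq_mul]
  push_cast
  field_simp
  ring

variable {Q : Measure Ω}

lemma integrable_pow_and_integral_of_hasLaw {T : Ω → ℝ} {m v : ℝ} (hm : 0 < m) (hv : 0 < v)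
    (hT : HasLaw T (inverseGaussian (1 / m) (1 / v ^ 2)) Q) (κ : ℕ) :
    Integrable (fun ω ↦ T ω ^ κ) Q ∧
      (1 ≤ κ → ∫ ω, T ω ^ κ ∂Q = 1 / m ^ κ * ∑ ζ ∈ Finset.range κ,
        ((κ - 1 + ζ).factorial : ℝ) / (ζ.factorial * (κ - 1 - ζ).factorial) *
          (2 * m / v ^ 2) ^ (-(ζ : ℤ))) := by
  have hi : Integrable (fun x : ℝ ↦ x ^ κ) (Q.map T) := by
    rw [hT.map_eq, integrable_inverseGaussian_iff hm hv]
    exact integrableOn_pow_mul_passageDensity hm hv κ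
  refine ⟨hi.comp_aemeasurable hT.aemeasurable, fun hκ ↦ ?_⟩
  have h := hT.integral_comp (f := fun x : ℝ ↦ x ^ κ) (by fun_prop)
  rw [integral_inverseGaussian hm hv, integral_pow_mul_passageDensity hm hv κ hκ] at h
  rw [show ∫ ω, T ω ^ κ ∂Q = _ from h, momentSum]
  congr 1
  refine Finset.sum_congr rfl fun ζ _ ↦ ?_
  rw [zpow_neg, zpow_natCast, ← inv_pow, inv_div]

/-- By the strong law of large numbers, the renewal-reward average over independent inverse
Gaussian times `l i` converges to the ratio of the expectations of `powerSum z (l i)` and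
`l i`. -/
lemma isAgeMoment_of_hasLaw [IsProbabilityMeasure Q] {l : ℕ → Ω → ℝ} {m v : ℝ} (hm : 0 < m)
    (hv : 0 < v) (hl : ∀ i, HasLaw (l i) (inverseGaussian (1 / m) (1 / v ^ 2)) Q)
    (hind : Pairwise fun i j ↦ IndepFun (l i) (l j) Q) {z : ℕ} (hz : 1 ≤ z) (i : ℕ) :
    IsAgeMoment l Q z (1 / (∫ ω, l i ω ∂Q) *
      ((∫ ω, l i ω ^ (z + 1) ∂Q) / (z + 1) + (∫ ω, l i ω ^ z ∂Q) / 2 +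
        ∑ κ ∈ Finset.Icc 2 z, (bernoulli κ : ℝ) / κ.factorial *
          (z.factorial * (∫ ω, l i ω ^ (z - κ + 1) ∂Q) / (z - κ + 1).factorial))) := by
  have hint : ∀ j k, Integrable (fun ω ↦ l j ω ^ k) Q := fun j k ↦
    (integrable_pow_and_integral_of_hasLaw hm hv (hl j) k).1
  have hident : ∀ i j, IdentDistrib (l i) (l j) Q Q := fun i j ↦
    ⟨(hl i).aemeasurable, (hl j).aemeasurable, (hl i).map_eq.trans (hl j).map_eq.symm⟩
  have hmean : ∫ ω, l i ω ∂Q = 1 / m := by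
    have := (integrable_pow_and_integral_of_hasLaw hm hv (hl i) 1).2 le_rfl
    simpa using this
  have hpm : Measurable (powerSum z) := by
    have : powerSum z = fun x ↦ _ := funext (powerSum_eq z hz)
    rw [this]
    fun_prop
  have hi1 : ∀ j, Integrable (l j) Q := fun j ↦ by simpa using hint j 1
  have hs : Integrable (fun ω ↦ ∑ κ ∈ Finset.Icc 2 z, (bernoulli κ : ℝ) / κ.factorial *
      (z.factorial * l i ω ^ (z - κ + 1) / (z - κ + 1).factorial)) Q :=
    integrable_finsetSum _ fun κ _ ↦ (((hint i _).const_mul _).div_const _).const_mul _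
  have h2 : Integrable (fun ω ↦ l i ω ^ (z + 1) / (z + 1) + l i ω ^ z / 2) Q :=
    ((hint i _).div_const _).add ((hint i _).div_const _)
  have hpi : Integrable (fun ω ↦ powerSum z (l i ω)) Q := by
    simp only [powerSum_eq z hz]
    exact h2.add hs
  have hpint : ∫ ω, powerSum z (l i ω) ∂Q =
      (∫ ω, l i ω ^ (z + 1) ∂Q) / (z + 1) + (∫ ω, l i ω ^ z ∂Q) / 2 +
        ∑ κ ∈ Finset.Icc 2 z, (bernoulli κ : ℝ) / κ.factorial *
          (z.factorial * (∫ ω, l i ω ^ (z - κ + 1) ∂Q) / (z - κ + 1).factorial) := by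
    simp only [powerSum_eq z hz]
    rw [integral_add h2 hs, integral_add ((hint i _).div_const _) ((hint i _).div_const _),
      integral_div, integral_div, integral_finsetSum _ fun κ _ ↦
        (((hint i _).const_mul _).div_const _).const_mul _]
    simp only [integral_const_mul, integral_div]
  have hpid : ∀ j k, IdentDistrib (fun ω ↦ powerSum z (l j ω)) (fun ω ↦ powerSum z (l k ω)) Q Q :=
    fun j k ↦ (hident j k).comp hpm
  have slln1 := strong_law_ae_real l (hi1 0) hind fun j ↦ hident j 0
  have slln2 := strong_law_ae_real (fun j ω ↦ powerSum z (l j ω)) ((hpid i 0).integrable_iff.1 hpi)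
    (fun j k hjk ↦ (hind hjk).comp hpm hpm) fun j ↦ hpid j 0
  rw [(hident 0 i).integral_eq, hmean] at slln1
  rw [(hpid 0 i).integral_eq] at slln2
  rw [← hpint, hmean, one_div_one_div]
  refine ⟨fun _ ↦ m * ∫ ω, powerSum z (l i ω) ∂Q, integrable_const _, ?_, by simp⟩
  filter_upwards [slln1, slln2] with ω h1 h2
  have h := h2.div h1 (by positivity)
  rw [div_div_eq_mul_div, div_one, mul_comm] at h
  refine h.congr' ?_
  filter_upwards [eventually_gt_atTop 0] with L hL
  have : (L : ℝ) ≠ 0 := by positivity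
  simp only [Pi.div_apply]
  rw [div_div_div_cancel_right₀ this]

end AoI

end

theorem theorem1
    {α : Type*} [Countable α] [MeasurableSpace α] [DiscreteMeasurableSpace α]
    {Ω : Type*} [MeasurableSpace Ω] (P : Measure Ω) [IsProbabilityMeasure P]
    {C N : ℕ} (K : AoI.UserChain α) (_hK : K.IsErgodic)
    (X : Fin C × Fin N → ℕ → Ω → α) (_hX : AoI.IsNetwork K X P)
    {Ω' : Type*} [MeasurableSpace Ω'] (Q : Measure Ω')
    (z : ℕ) (_hz : 1 ≤ z) :
    -- active users
    (∀ (c : Fin C) (n : Fin N) (m v : ℝ), 0 < m → 0 < v →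
      AoI.HasMean (AoI.delivery K X c n) P m →
      AoI.HasTemporalVariance (AoI.delivery K X c n) P m (v ^ 2) →
      ∀ D : ℝ≥0 → Ω' → ℝ, AoI.IsBrownianWithDrift D m v Q →
        (∀ᵐ ω ∂Q, ∀ i, IsLeast (AoI.increaseTimes D ω (AoI.deliveryTime D i ω))
          (AoI.deliveryTime D (i + 1) ω)) ∧
        (∀ i, HasLaw (AoI.gap D i) (AoI.inverseGaussian (1 / m) (1 / v ^ 2)) Q) ∧
        (∀ i, AoI.IsAgeMoment (AoI.gap D) Q z
          (1 / (∫ ω, AoI.gap D i ω ∂Q) *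
            ((∫ ω, AoI.gap D i ω ^ (z + 1) ∂Q) / (z + 1) + (∫ ω, AoI.gap D i ω ^ z ∂Q) / 2 +
              ∑ κ ∈ Finset.Icc 2 z, (bernoulli κ : ℝ) / κ.factorial *
                (z.factorial * (∫ ω, AoI.gap D i ω ^ (z - κ + 1) ∂Q) /
                  (z - κ + 1).factorial)))) ∧
        (∀ i κ, 1 ≤ κ →
          Integrable (fun ω => AoI.gap D i ω ^ κ) Q ∧
          ∫ ω, AoI.gap D i ω ^ κ ∂Q = 1 / m ^ κ *
            ∑ ζ ∈ Finset.range κ,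
              ((κ - 1 + ζ).factorial : ℝ) / (ζ.factorial * (κ - 1 - ζ).factorial) *
                (2 * m / v ^ 2) ^ (-(ζ : ℤ)))) ∧
    -- passive users
    (∀ m v : ℝ, 0 < m → 0 < v →
      AoI.HasMean (AoI.detection K X) P m →
      AoI.HasTemporalVariance (AoI.detection K X) P m (v ^ 2) →
      ∀ D : ℝ≥0 → Ω' → ℝ, AoI.IsBrownianWithDrift D m v Q →
        (∀ᵐ ω ∂Q, ∀ i, IsLeast (AoI.increaseTimes D ω (AoI.deliveryTime D i ω))
          (AoI.deliveryTime D (i + 1) ω)) ∧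
        (∀ i, HasLaw (AoI.gap D i) (AoI.inverseGaussian (1 / m) (1 / v ^ 2)) Q) ∧
        (∀ i, AoI.IsAgeMoment (AoI.gap D) Q z
          (1 / (∫ ω, AoI.gap D i ω ∂Q) *
            ((∫ ω, AoI.gap D i ω ^ (z + 1) ∂Q) / (z + 1) + (∫ ω, AoI.gap D i ω ^ z ∂Q) / 2 +
              ∑ κ ∈ Finset.Icc 2 z, (bernoulli κ : ℝ) / κ.factorial *
                (z.factorial * (∫ ω, AoI.gap D i ω ^ (z - κ + 1) ∂Q) /
                  (z - κ + 1).factorial)))) ∧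
        (∀ i κ, 1 ≤ κ →
          Integrable (fun ω => AoI.gap D i ω ^ κ) Q ∧
          ∫ ω, AoI.gap D i ω ^ κ ∂Q = 1 / m ^ κ *
            ∑ ζ ∈ Finset.range κ,
              ((κ - 1 + ζ).factorial : ℝ) / (ζ.factorial * (κ - 1 - ζ).factorial) *
                (2 * m / v ^ 2) ^ (-(ζ : ℤ)))) := by
  -- the claims about `D` are the same for both kinds of users
  refine ⟨fun _ _ m v hm hv _ _ D hD ↦ ?_, fun m v hm hv _ _ D hD ↦ ?_⟩ <;>
  · obtain ⟨B, hB, -⟩ := id hD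
    have : IsProbabilityMeasure Q := hB.isGaussianProcess.isProbabilityMeasure
    obtain ⟨hleast, hlaw, hind⟩ := AoI.hasLaw_gap_and_indepFun hm hv hD
    exact ⟨hleast, hlaw, AoI.isAgeMoment_of_hasLaw hm hv hlaw hind _hz, fun i κ hκ ↦
      ⟨(AoI.integrable_pow_and_integral_of_hasLaw hm hv (hlaw i) κ).1,
        (AoI.integrable_pow_and_integral_of_hasLaw hm hv (hlaw i) κ).2 hκ⟩⟩
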